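/- Let $(M^{2n},J,ds^2)$ be an almost Hermitian manifold: $M$ is a smooth $2n$-dimensional manifold with a Riemannian metric $ds^2$, and $J$ is a smooth endomorphism field of $TM$ with $J^2=-\mathrm{Id}$ and $ds^2(JX,JY)=ds^2(X,Y)$; $M$ is oriented so that the orthonormal frames of the form $(e_1,\dots,e_n,Je_1,\dots,Je_n)$ are positive. Let $N(X,Y)=[JX,JY]-[X,Y]-J[JX,Y]-J[X,JY]$ be the Nijenhuis tensor and $|N|^2=\sum_{A,B=1}^{2n}|N(e_A,e_B)|^2$, where $(e_A)$ is any orthonormal basis of the tangent space. Put $J_0=\begin{pmatrix}0&-I_n\\ I_n&0\end{pmatrix}$ and $\Sigma=\{\psi\in\mathfrak{so}(2n):\psi J_0=-J_0\psi\}$. Let $P_+$ be the bundle of positive orthonormal frames $e=(e_1,\dots,e_{2n})$ of $M$, and let $J_+=J_+(M,ds^2)$ be the twistor bundle, whose fibre at $x$ consists of the orthogonal complex structures of $T_xM$ that are compatible with the orientation. Let $\xi:P_+\to J_+$ be the projection $\xi(e)(e_1,\dots,e_{2n})=(e_1,\dots,e_{2n})J_0$, let $\Omega$ be the $\mathfrak{so}(2n)$-valued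 Levi-Civita connection form on $P_+$, and let $\Theta$ be the canonical $\mathbb{R}^{2n}$-valued form on $P_+$, $\Theta_A(\widetilde X)=ds^2(p_*\widetilde X,e_A)$, where $p:P_+\to M$ is the projection. For $e\in P_+$ there is a linear isomorphism $$\lambda(e):T_{\xi(e)}J_+\to\Sigma\oplus\mathbb{R}^{2n},\qquad \bar X\mapsto\Big(\tfrac12(\Omega+J_0\Omega J_0)(\widetilde X),\ \Theta(\widetilde X)\Big),\quad \widetilde X\in T_eP_+,\ \xi_*\widetilde X=\bar X.$$ Pulling back by $\lambda(e)$ the complex structure $(\psi,V)\mapsto(J_0\psi,-VJ_0)$ (with $V$ a row vector) and the inner product $\langle(\psi,V),(\psi',V')\rangle=-\mathrm{tr}(\psi\psi')+V\cdot V'$ gives an almost complex structure $J_1$ and a compatible metric $ds^2_{J_1}$ on $J_+$ that do not depend on the choice of $e$ over a given point; let $\Phi(\bar X,\bar Y)=ds^2_{J_1}(J_1\bar X,\bar Y)$ be the Kähler form. Let $S:M\to J_+$ be the section given by $J$, and let $\varphi=S^*\Phi$, a $2$-form on $M$. Then for every $x\in M$ and every $X\in T_xM$: 1. if $n\ge 3$,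 then $\varphi(X,JX)\ge|X|^2\big(1-\tfrac{5}{64}|N|^2\big)$, and $\varphi$ is non-degenerate at every point at which $|N|^2<\tfrac{64}{5}$; 2. if $n=2$, then $\varphi(X,JX)\ge|X|^2\big(1-\tfrac1{16}|N|^2\big)$, and $\varphi$ is non-degenerate at every point at which $|N|^2<16$. -/

import Mathlib

open Bundle
open scoped Manifold ContDiff

noncomputable section

namespace AlmostHermitian

/-- The model space of the `2n`-dimensional manifolds considered here. -/
abbrev Model (n : ℕ) : Type := EuclideanSpace ℝ (Fin (2 * n))

/-- Euclidean `ℝ^{2n}` with the coordinates split as `(x_1, …, x_n ; x_{n+1}, …, x_{2n})`. -/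
abbrev R2n (n : ℕ) : Type := EuclideanSpace ℝ (Fin n ⊕ Fin n)

/-- Endomorphisms of `ℝ^{2n}`, i.e. real `2n × 2n` matrices. -/
abbrev End2n (n : ℕ) : Type := R2n n →L[ℝ] R2n n

/-- The `A`-th standard basis vector of `ℝ^{2n}`. -/
def stdVec (n : ℕ) (A : Fin n ⊕ Fin n) : R2n n := EuclideanSpace.single A (1 : ℝ)

/-- The standard complex structure `J₀ = [[0, -1], [1, 0]]` of `ℝ^{2n}`. -/
def J₀ (n : ℕ) : End2n n := Matrix.toEuclideanCLM (𝕜 := ℝ) (Matrix.J (Fin n) ℝ)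

/-- The Lie algebra `𝔰𝔬(2n)`. -/
def IsSkew {n : ℕ} (l : End2n n) : Prop := ContinuousLinearMap.adjoint l = -l

/-- The inner product `⟨P, Q⟩ = -tr (P Q)` on `𝔰𝔬(2n)`. -/
def soInner {n : ℕ} (P Q : End2n n) : ℝ :=
  -(LinearMap.trace ℝ (R2n n) ((P ∘L Q : End2n n) : R2n n →ₗ[ℝ] R2n n))

section Manifold

variable {n : ℕ} {M : Type*} [TopologicalSpace M] [ChartedSpace (Model n) M]
  [IsManifold (𝓡 (2 * n)) ∞ M]

/-! ### Almost complex structures and the Nijenhuis tensor -/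

/-- A field of endomorphisms of the tangent bundle, regarded as a section of `End(TM)`. -/
def endSection (J : ∀ x : M, TangentSpace (𝓡 (2 * n)) x →L[ℝ] TangentSpace (𝓡 (2 * n)) x)
    (x : M) : TotalSpace (Model n →L[ℝ] Model n)
      (fun x : M ↦ TangentSpace (𝓡 (2 * n)) x →L[ℝ] TangentSpace (𝓡 (2 * n)) x) :=
  ⟨x, J x⟩

/-- The expression `[JX, JY] - [X, Y] - J[JX, Y] - J[X, JY]` for vector fields `X`, `Y`. -/
def nijenhuisField (J : ∀ x : M, TangentSpace (𝓡 (2 * n)) x →L[ℝ] TangentSpace (𝓡 (2 * n)) x)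
    (X Y : ∀ x : M, TangentSpace (𝓡 (2 * n)) x) (x : M) : TangentSpace (𝓡 (2 * n)) x :=
  VectorField.mlieBracket (𝓡 (2 * n)) (fun y ↦ J y (X y)) (fun y ↦ J y (Y y)) x
    - VectorField.mlieBracket (𝓡 (2 * n)) X Y x
    - J x (VectorField.mlieBracket (𝓡 (2 * n)) (fun y ↦ J y (X y)) Y x)
    - J x (VectorField.mlieBracket (𝓡 (2 * n)) X (fun y ↦ J y (Y y)) x)

/-- The Nijenhuis tensor on tangent vectors at `x`. The vectors are extended to vector fields that
are smooth near `x`; by tensoriality the choice of the extensions is irrelevant. -/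
def nijenhuis (J : ∀ x : M, TangentSpace (𝓡 (2 * n)) x →L[ℝ] TangentSpace (𝓡 (2 * n)) x)
    (x : M) (v w : TangentSpace (𝓡 (2 * n)) x) : TangentSpace (𝓡 (2 * n)) x :=
  nijenhuisField J (FiberBundle.extend (Model n) v) (FiberBundle.extend (Model n) w) x

variable [RiemannianBundle (fun x : M ↦ TangentSpace (𝓡 (2 * n)) x)]

/-- `(M, J, ds²)` is an almost Hermitian manifold: `J` is a smooth orthogonal almost complex
structure. The metric `ds²` is the Riemannian structure carried by the tangent bundle. -/
structure IsAlmostHermitian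
    (J : ∀ x : M, TangentSpace (𝓡 (2 * n)) x →L[ℝ] TangentSpace (𝓡 (2 * n)) x) : Prop where
  smooth : ContMDiff (𝓡 (2 * n)) ((𝓡 (2 * n)).prod 𝓘(ℝ, Model n →L[ℝ] Model n)) ∞ (endSection J)
  sq : ∀ (x : M) (v : TangentSpace (𝓡 (2 * n)) x), J x (J x v) = -v
  orth : ∀ (x : M) (v w : TangentSpace (𝓡 (2 * n)) x), inner ℝ (J x v) (J x w) = inner ℝ v w

/-- `|N|² = ∑_{A,B} |N(e_A, e_B)|²` at the point `x`, for an orthonormal basis `(e_A)` of the tangent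
space (the sum does not depend on the basis). -/
def nijenhuisNormSq (J : ∀ x : M, TangentSpace (𝓡 (2 * n)) x →L[ℝ] TangentSpace (𝓡 (2 * n)) x)
    (x : M) : ℝ :=
  haveI : FiniteDimensional ℝ (TangentSpace (𝓡 (2 * n)) x) :=
    inferInstanceAs (FiniteDimensional ℝ (Model n))
  ∑ A, ∑ B, ‖nijenhuis J x (stdOrthonormalBasis ℝ (TangentSpace (𝓡 (2 * n)) x) A)
    (stdOrthonormalBasis ℝ (TangentSpace (𝓡 (2 * n)) x) B)‖ ^ 2

/-! ### The Levi-Civita connection -/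

/-- The right-hand side of the Koszul formula for `2⟨∇_X Y, Z⟩`:
`X⟨Y,Z⟩ + Y⟨X,Z⟩ - Z⟨X,Y⟩ + ⟨[X,Y],Z⟩ - ⟨[X,Z],Y⟩ - ⟨[Y,Z],X⟩`. -/
def koszul (X Y Z : ∀ x : M, TangentSpace (𝓡 (2 * n)) x) (x : M) : ℝ :=
  mvfderiv (𝓡 (2 * n)) (fun y ↦ inner ℝ (Y y) (Z y)) x (X x)
    + mvfderiv (𝓡 (2 * n)) (fun y ↦ inner ℝ (X y) (Z y)) x (Y x)
    - mvfderiv (𝓡 (2 * n)) (fun y ↦ inner ℝ (X y) (Y y)) x (Z x)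
    + inner ℝ (VectorField.mlieBracket (𝓡 (2 * n)) X Y x) (Z x)
    - inner ℝ (VectorField.mlieBracket (𝓡 (2 * n)) X Z x) (Y x)
    - inner ℝ (VectorField.mlieBracket (𝓡 (2 * n)) Y Z x) (X x)

/-- The Levi-Civita covariant derivative `∇_v Y` of a vector field `Y` at `x` in the direction `v`:
the vector whose inner products with an orthonormal basis are given by the Koszul formula. -/
def leviCivita (Y : ∀ x : M, TangentSpace (𝓡 (2 * n)) x) (x : M)
    (v : TangentSpace (𝓡 (2 * n)) x) : TangentSpace (𝓡 (2 * n)) x :=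
  haveI : FiniteDimensional ℝ (TangentSpace (𝓡 (2 * n)) x) :=
    inferInstanceAs (FiniteDimensional ℝ (Model n))
  ∑ A, ((1 / 2 : ℝ) * koszul (FiberBundle.extend (Model n) v) Y
      (FiberBundle.extend (Model n) (stdOrthonormalBasis ℝ (TangentSpace (𝓡 (2 * n)) x) A)) x) •
    stdOrthonormalBasis ℝ (TangentSpace (𝓡 (2 * n)) x) A

/-! ### The frame bundle `P₊` and the twistor bundle `J₊`

Both are embedded submanifolds of total spaces of smooth vector bundles, `P₊` of
`Hom(ℝ^{2n}, TM)` and `J₊` of `End(TM)`. A frame `e = (e_1, …, e_{2n})` at `x` is the linear map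
`ℝ^{2n} → T_xM` with `e_A = e (stdVec A)`, so that `(e_1, …, e_{2n}) A = e ∘ A` for a matrix `A`. -/

variable (n M) in
/-- The total space of the vector bundle `Hom(ℝ^{2n}, TM)`. -/
abbrev FrameSpace : Type _ :=
  TotalSpace (R2n n →L[ℝ] Model n)
    (fun x : M ↦ Bundle.Trivial M (R2n n) x →L[ℝ] TangentSpace (𝓡 (2 * n)) x)

variable (n M) in
/-- The total space of the vector bundle `End(TM)`. -/
abbrev EndSpace : Type _ :=
  TotalSpace (Model n →L[ℝ] Model n)
    (fun x : M ↦ TangentSpace (𝓡 (2 * n)) x →L[ℝ] TangentSpace (𝓡 (2 * n)) x)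

/-- The model with corners of the manifold `FrameSpace n M`. -/
abbrev frameModel (n : ℕ) := (𝓡 (2 * n)).prod 𝓘(ℝ, R2n n →L[ℝ] Model n)

/-- The model with corners of the manifold `EndSpace n M`. -/
abbrev endModel (n : ℕ) := (𝓡 (2 * n)).prod 𝓘(ℝ, Model n →L[ℝ] Model n)

/-- The `A`-th vector of a frame. -/
def frameVec (e : FrameSpace n M) (A : Fin n ⊕ Fin n) : TangentSpace (𝓡 (2 * n)) e.proj :=
  e.snd (stdVec n A)

/-- The bundle `P₊(M, ds²)` of positively oriented orthonormal frames. -/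
def frameBundle (o : ∀ x : M, Orientation ℝ (TangentSpace (𝓡 (2 * n)) x) (Fin n ⊕ Fin n)) :
    Set (FrameSpace n M) :=
  {e | ∃ b : OrthonormalBasis (Fin n ⊕ Fin n) ℝ (TangentSpace (𝓡 (2 * n)) e.proj),
    (∀ A, b A = frameVec e A) ∧ b.toBasis.orientation = o e.proj}

/-- The twistor bundle `J₊(M, ds²)`: orthogonal complex structures of the tangent spaces that are
compatible with the orientation, i.e. for which some (equivalently, every) orthonormal basis of the
form `(e_1, …, e_n, Je_1, …, Je_n)` is positive. -/
def twistorBundle (o : ∀ x : M, Orientation ℝ (TangentSpace (𝓡 (2 * n)) x) (Fin n ⊕ Fin n)) :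
    Set (EndSpace n M) :=
  {j | (∀ v, j.snd (j.snd v) = -v) ∧
    (∀ v w : TangentSpace (𝓡 (2 * n)) j.proj, inner ℝ (j.snd v) (j.snd w) = inner ℝ v w) ∧
    ∃ b : OrthonormalBasis (Fin n ⊕ Fin n) ℝ (TangentSpace (𝓡 (2 * n)) j.proj),
      (∀ i, b (Sum.inr i) = j.snd (b (Sum.inl i))) ∧ b.toBasis.orientation = o j.proj}

/-- The projection `ξ`, `ξ(e)(e_1, …, e_{2n}) = (e_1, …, e_{2n}) J₀`, i.e. `ξ(e) = e J₀ e⁻¹`. It is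
defined on all frames and smooth near the invertible ones. -/
def xi (e : FrameSpace n M) : EndSpace n M :=
  ⟨e.proj, (ContinuousLinearMap.comp (e.snd : R2n n →L[ℝ] TangentSpace (𝓡 (2 * n)) e.proj)
    (J₀ n)) ∘L ContinuousLinearMap.inverse
      (e.snd : R2n n →L[ℝ] TangentSpace (𝓡 (2 * n)) e.proj)⟩

/-- The tangent space `T_e P₊`. Among the frames, the orthonormal ones form a regular level set of
the Gram matrix `(⟨e_A, e_B⟩)`, so that `T_e P₊` is the kernel of its differential. -/
def tangentFrame (e : FrameSpace n M) : Submodule ℝ (TangentSpace (frameModel n) e) :=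
  ⨅ A : Fin n ⊕ Fin n, ⨅ B : Fin n ⊕ Fin n,
    LinearMap.ker (mvfderiv (frameModel n)
      (fun f : FrameSpace n M ↦ inner ℝ (frameVec f A) (frameVec f B)) e).toLinearMap

/-- The differential `ξ_*` at `e`. -/
def xiStar (e : FrameSpace n M) :
    TangentSpace (frameModel n) e →L[ℝ] TangentSpace (endModel n) (xi e) :=
  mfderiv (frameModel n) (endModel n) xi e

/-- The tangent space `T_{ξ(e)} J₊`, for `e` in `P₊`: the image of `T_e P₊` under the differential of
the submersion `ξ : P₊ → J₊`. It depends on `ξ(e)` only. -/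
def tangentTwistor (e : FrameSpace n M) : Submodule ℝ (TangentSpace (endModel n) (xi e)) :=
  (tangentFrame e).map (xiStar e).toLinearMap

/-! ### The connection form `Ω` and the canonical form `Θ` on `P₊` -/

/-- The value at `e` of the fundamental vector field of `l`, the velocity of `t ↦ e exp(tl)`. -/
def fundamental (e : FrameSpace n M) (l : End2n n) : TangentSpace (frameModel n) e :=
  mfderiv 𝓘(ℝ, ℝ) (frameModel n)
    (fun t : ℝ ↦ (⟨e.proj, ContinuousLinearMap.comp
      (e.snd : R2n n →L[ℝ] TangentSpace (𝓡 (2 * n)) e.proj) (NormedSpace.exp (t • l))⟩ :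
        FrameSpace n M)) 0 (1 : ℝ)

/-- The horizontal space `H_e` of the Levi-Civita connection: the vectors `s_* v` where `s` is a
frame field, smooth near the base point, with value `e` there and such that `∇_v s_A = 0` for
all `A`. -/
def horizontal (e : FrameSpace n M) : Set (TangentSpace (frameModel n) e) :=
  {Z | ∃ (s : ∀ y : M, Bundle.Trivial M (R2n n) y →L[ℝ] TangentSpace (𝓡 (2 * n)) y)
      (v : TangentSpace (𝓡 (2 * n)) e.proj),
    s e.proj = e.snd ∧
    ContMDiffAt (𝓡 (2 * n)) (frameModel n) ∞ (fun y ↦ (⟨y, s y⟩ : FrameSpace n M)) e.proj ∧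
    (∀ A, leviCivita (fun y ↦ frameVec (⟨y, s y⟩ : FrameSpace n M) A) e.proj v = 0) ∧
    mfderiv (𝓡 (2 * n)) (frameModel n) (fun y ↦ (⟨y, s y⟩ : FrameSpace n M)) e.proj v = Z}

/-- The Levi-Civita connection form `Ω` on `P₊`: the unique `l ∈ 𝔰𝔬(2n)` whose fundamental vector is
the vertical component of the given tangent vector, i.e. differs from it by a horizontal one. -/
def Omega (e : FrameSpace n M) (X : TangentSpace (frameModel n) e) : End2n n :=
  Classical.epsilon fun l ↦ IsSkew l ∧ X - fundamental e l ∈ horizontal e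

/-- The canonical form `Θ` on `P₊`, `Θ_A(X) = ds²(p_* X, e_A)`. -/
def Theta (e : FrameSpace n M) (X : TangentSpace (frameModel n) e) : R2n n :=
  WithLp.toLp 2 fun A ↦
    inner ℝ (mfderiv (frameModel n) (𝓡 (2 * n))
      (fun f : FrameSpace n M ↦ f.proj) e X : TangentSpace (𝓡 (2 * n)) e.proj) (frameVec e A)

/-! ### The almost Hermitian structure of `J₊` -/

/-- The isomorphism `λ(e) : T_{ξ(e)} J₊ → Σ ⊕ ℝ^{2n}`, `X ↦ (½(Ω + J₀ Ω J₀)(X̃), Θ(X̃))`, where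
`X̃ ∈ T_e P₊` is any vector with `ξ_* X̃ = X`. -/
def lam (e : FrameSpace n M) (X : TangentSpace (endModel n) (xi e)) : End2n n × R2n n :=
  let X' : TangentSpace (frameModel n) e :=
    Classical.epsilon fun Y ↦ Y ∈ tangentFrame e ∧ xiStar e Y = X
  ((1 / 2 : ℝ) • (Omega e X' + J₀ n ∘L Omega e X' ∘L J₀ n), Theta e X')

/-- The complex structure `(ψ, V) ↦ (J₀ ψ, -V J₀)` of `Σ ⊕ ℝ^{2n}`. The vectors `V` are rows there;
for columns, `-V J₀` is `J₀ V`. -/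
def modelJ (p : End2n n × R2n n) : End2n n × R2n n := (J₀ n ∘L p.1, J₀ n p.2)

/-- The canonical inner product of `Σ ⊕ ℝ^{2n}`. -/
def modelInner (p q : End2n n × R2n n) : ℝ := soInner p.1 q.1 + inner ℝ p.2 q.2

/-- The almost complex structure `J₁` of `J₊` at `ξ(e)`: the pull-back of `modelJ` by `λ(e)`. -/
def J₁ (e : FrameSpace n M) (X : TangentSpace (endModel n) (xi e)) :
    TangentSpace (endModel n) (xi e) :=
  Classical.epsilon fun Z ↦ Z ∈ tangentTwistor e ∧ lam e Z = modelJ (lam e X)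

/-- The metric of `J₊` at `ξ(e)`: the pull-back of `modelInner` by `λ(e)`. -/
def twistorMetric (e : FrameSpace n M) (X Y : TangentSpace (endModel n) (xi e)) : ℝ :=
  modelInner (lam e X) (lam e Y)

/-- The Kähler form `Φ(X, Y) = ds²_{J₁}(J₁ X, Y)` of the twistor bundle, at a point `j` of `J₊`. It
is computed with a frame `e` in `P₊` such that `ξ(e) = j`; since `λ(e)` is equivariant under `U(n)`,
the frame does not matter. -/
def Phi (o : ∀ x : M, Orientation ℝ (TangentSpace (𝓡 (2 * n)) x) (Fin n ⊕ Fin n))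
    (j : EndSpace n M) (X Y : TangentSpace (endModel n) j) : ℝ :=
  haveI : Nonempty (FrameSpace n M) := ⟨⟨j.proj, 0⟩⟩
  let e : FrameSpace n M := Classical.epsilon fun e ↦ e ∈ frameBundle o ∧ xi e = j
  twistorMetric e (J₁ e X) Y

/-- The form `φ = S^* Φ` on `M`, where `S : M → J₊` is the section given by `J`. -/
def phi (o : ∀ x : M, Orientation ℝ (TangentSpace (𝓡 (2 * n)) x) (Fin n ⊕ Fin n))
    (J : ∀ x : M, TangentSpace (𝓡 (2 * n)) x →L[ℝ] TangentSpace (𝓡 (2 * n)) x)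
    (x : M) (X Y : TangentSpace (𝓡 (2 * n)) x) : ℝ :=
  Phi o (endSection J x) (mfderiv (𝓡 (2 * n)) (endModel n) (endSection J) x X)
    (mfderiv (𝓡 (2 * n)) (endModel n) (endSection J) x Y)

end Manifold

end AlmostHermitian

end

/-!
Fix a point `x` and write `Q_X = ∇_X J` for the covariant derivative of the almost complex structure
at `x`. It is skew and anticommutes with `J` (`nabla_skew`, `nabla_anti`).

In a frame `e` with `ξ(e) = J`, let `q` be the matrix of `Q_X`. The isomorphism `λ(e)` maps the vector
`S_* X` to `(½ J₀ q, e⁻¹ X)`: the vector of `T_e P₊` on which the connection form is `½ J₀ q` and which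
lies over `X` is mapped by `ξ_*` to `S_* X` (`mfderiv_endSection`, `lam_xiStar_frameLift`). Hence
`φ(X, Y) = ⟨JX, Y⟩ - ¼ tr (J Q_X Q_Y)` (`phi_eq`), which is alternating as `J` is skew. All of this is
computed in the trivialization of `TM` at `x`, where a connection is given by its Christoffel symbol
`Γ`: the connection form is `Ω(v, a) = e⁻¹ (a + Γ_v e)` (`Omega_frameTangent`).

Put `D_X = Q_{JX} - J Q_X` and `E_X = Q_{JX} + J Q_X`. In the Hilbert-Schmidt norm, polarization gives
`φ(X, JX) = |X|² + (|E_X|² - |D_X|²) / 16 ≥ |X|² - |D_X|² / 16`. The Levi-Civita connection being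
torsion free, `N(X, Y) = D_X Y - D_Y X` (`nijenhuis_eq`). As `D_X` is skew, `D` is recovered from `N`
as a metric connection is from its torsion:
`2 ⟨D_X Y, Z⟩ = ⟨N(X, Y), Z⟩ - ⟨N(Y, Z), X⟩ + ⟨N(Z, X), Y⟩` (`two_mul_inner_of_skew`). Moreover
`D_{JX} = -J D_X`, so that `|D_X| = |D_{JX}|`, and adding the estimates for `X` and `JX` gives
`|D_X|² ≤ ¾ |N|² |X|²` (`sum_norm_sq_le`). Therefore `φ(X, JX) ≥ |X|² (1 - 3/64 |N|²)` in every
dimension (`le_twistorForm`), and `3/64` is smaller than both `5/64` and `1/16`. Where the bracket is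
positive, `φ(X, JX) > 0` for `X ≠ 0`, so that `φ` is nondegenerate.
-/

noncomputable section

open Filter Topology

/-! ### Derivatives in coordinates -/

section VectorValued

variable {F₁ F₂ F₃ : Type*} [NormedAddCommGroup F₁] [NormedSpace ℝ F₁] [NormedAddCommGroup F₂]
  [NormedSpace ℝ F₂] [NormedAddCommGroup F₃] [NormedSpace ℝ F₃]
  {EN : Type*} [NormedAddCommGroup EN] [NormedSpace ℝ EN]
  {HN : Type*} [TopologicalSpace HN] {IN : ModelWithCorners ℝ EN HN}
  {N : Type*} [TopologicalSpace N] [ChartedSpace HN N] {p : N}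

theorem HasFDerivAt.comp_hasMFDerivAt {g : F₁ → F₂} {g' : F₁ →L[ℝ] F₂} {f : N → F₁}
    {f' : TangentSpace IN p →L[ℝ] F₁} (hg : HasFDerivAt g g' (f p))
    (hf : HasMFDerivAt IN 𝓘(ℝ, F₁) f p f') :
    HasMFDerivAt IN 𝓘(ℝ, F₂) (fun q ↦ g (f q)) p (g' ∘L f') :=
  HasMFDerivAt.comp (x := p) hg.hasMFDerivAt hf

theorem ContinuousLinearMap.comp_hasMFDerivAt (g : F₁ →L[ℝ] F₂) {f : N → F₁}
    {f' : TangentSpace IN p →L[ℝ] F₁} (hf : HasMFDerivAt IN 𝓘(ℝ, F₁) f p f') :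
    HasMFDerivAt IN 𝓘(ℝ, F₂) (fun q ↦ g (f q)) p (g ∘L f') :=
  g.hasFDerivAt.comp_hasMFDerivAt hf

/-- The product rule. -/
theorem ContinuousLinearMap.hasMFDerivAt_of_bilinear (B : F₁ →L[ℝ] F₂ →L[ℝ] F₃) {a : N → F₁}
    {b : N → F₂} {a' : TangentSpace IN p →L[ℝ] F₁} {b' : TangentSpace IN p →L[ℝ] F₂}
    (ha : HasMFDerivAt IN 𝓘(ℝ, F₁) a p a') (hb : HasMFDerivAt IN 𝓘(ℝ, F₂) b p b') :
    HasMFDerivAt IN 𝓘(ℝ, F₃) (fun q ↦ B (a q) (b q)) p (B (a p) ∘L b' + B.flip (b p) ∘L a') := by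
  have hab : HasMFDerivAt IN 𝓘(ℝ, F₁ × F₂) (fun q ↦ (a q, b q)) p (a'.prod b') :=
    ⟨ha.1.prodMk hb.1, ha.2.prodMk hb.2⟩
  have h := HasFDerivAt.comp_hasMFDerivAt (f := fun q ↦ (a q, b q))
    (B.isBoundedBilinearMap.hasFDerivAt (a p, b p)) hab
  refine h.congr_mfderiv ?_
  ext1 X
  rfl

end VectorValued

section TotalSpace

variable {F : Type*} [NormedAddCommGroup F] [NormedSpace ℝ F]
  {EB : Type*} [NormedAddCommGroup EB] [NormedSpace ℝ EB]
  {HB : Type*} [TopologicalSpace HB] {IB : ModelWithCorners ℝ EB HB}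
  {B : Type*} [TopologicalSpace B] [ChartedSpace HB B]
  {E : B → Type*} [TopologicalSpace (TotalSpace F E)] [∀ x, TopologicalSpace (E x)]
  [FiberBundle F E]
  {EN : Type*} [NormedAddCommGroup EN] [NormedSpace ℝ EN]
  {HN : Type*} [TopologicalSpace HN] {IN : ModelWithCorners ℝ EN HN}
  {N : Type*} [TopologicalSpace N] [ChartedSpace HN N]

/-- In the product chart of the total space of a fibre bundle, a map is given by its base map and
its fibre coordinate, and so is its derivative. -/
theorem HasMFDerivAt.totalSpace {f : N → TotalSpace F E} {p : N}
    {b' : TangentSpace IN p →L[ℝ] EB} {a' : TangentSpace IN p →L[ℝ] F}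
    (hb : HasMFDerivAt IN IB (fun q ↦ (f q).proj) p b')
    (ha : HasMFDerivAt IN 𝓘(ℝ, F) (fun q ↦ (trivializationAt F E (f p).proj (f q)).2) p a') :
    HasMFDerivAt IN (IB.prod 𝓘(ℝ, F)) f p (b'.prod a') := by
  have hc : ContinuousAt f p :=
    (FiberBundle.continuousAt_totalSpace F f).2 ⟨hb.1, ha.1⟩
  refine ⟨hc, ?_⟩
  have h := hb.2.prodMk ha.2
  refine h.congr_of_eventuallyEq ?_ ?_
  · have h1 : (fun q ↦ (f q).proj) ⁻¹' (trivializationAt F E (f p).proj).baseSet ∈ 𝓝 p :=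
      hb.1 ((Trivialization.open_baseSet _).mem_nhds (mem_baseSet_trivializationAt F E _))
    have h2 : ∀ᶠ z in 𝓝[Set.range IN] (extChartAt IN p p),
        (extChartAt IN p).symm z ∈ (fun q ↦ (f q).proj) ⁻¹'
          (trivializationAt F E (f p).proj).baseSet := by
      have := (continuousAt_extChartAt_symm (I := IN) p)
      rw [ContinuousAt, extChartAt_to_inv] at this
      exact (this.mono_left nhdsWithin_le_nhds) h1
    filter_upwards [h2] with z hz
    simp only [writtenInExtChartAt, Function.comp_apply, FiberBundle.extChartAt,
      PartialEquiv.coe_trans, PartialEquiv.prod_coe, PartialEquiv.refl_coe]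
    simp only [OpenPartialHomeomorph.coe_toPartialEquiv, Trivialization.coe_coe,
      extChartAt_self_apply, modelWithCornersSelf_coe, id_eq]
    rw [Trivialization.coe_fst' _ hz]
  · simp only [writtenInExtChartAt, Function.comp_apply, FiberBundle.extChartAt,
      PartialEquiv.coe_trans, PartialEquiv.prod_coe, PartialEquiv.refl_coe]
    simp only [OpenPartialHomeomorph.coe_toPartialEquiv, Trivialization.coe_coe,
      extChartAt_self_apply, modelWithCornersSelf_coe, id_eq, extChartAt_to_inv]
    rw [Trivialization.coe_fst' _ (mem_baseSet_trivializationAt F E _)]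

/-- The base projection of a total space and its fibre coordinate at `e` are the two components of
the tangent space at `e`. -/
theorem hasMFDerivAt_totalSpace_proj_coord (e : TotalSpace F E) :
    HasMFDerivAt (IB.prod 𝓘(ℝ, F)) IB (fun f : TotalSpace F E ↦ f.proj) e
      (ContinuousLinearMap.fst ℝ EB F) ∧
    HasMFDerivAt (IB.prod 𝓘(ℝ, F)) 𝓘(ℝ, F)
      (fun f : TotalSpace F E ↦ (trivializationAt F E e.proj f).2) e
      (ContinuousLinearMap.snd ℝ EB F) := by
  have hid : MDifferentiableAt (IB.prod 𝓘(ℝ, F)) (IB.prod 𝓘(ℝ, F))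
    (fun f : TotalSpace F E ↦ f) e := mdifferentiableAt_id
  obtain ⟨h1, h2⟩ := (mdifferentiableAt_totalSpace IB (fun f : TotalSpace F E ↦ f)).1 hid
  have h3 := HasMFDerivAt.totalSpace (f := fun f : TotalSpace F E ↦ f)
    h1.hasMFDerivAt h2.hasMFDerivAt
  have h4 := hasMFDerivAt_unique h3 (hasMFDerivAt_id e)
  have h5 : ∀ X : EB × F, (mfderiv (IB.prod 𝓘(ℝ, F)) IB (fun f : TotalSpace F E ↦ f.proj) e X,
      mfderiv (IB.prod 𝓘(ℝ, F)) 𝓘(ℝ, F)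
        (fun f : TotalSpace F E ↦ (trivializationAt F E e.proj f).2) e X) = X :=
    fun X ↦ DFunLike.congr_fun h4 X
  constructor
  · exact h1.hasMFDerivAt.congr_mfderiv
      (ContinuousLinearMap.ext fun X ↦ congrArg Prod.fst (h5 X))
  · exact h2.hasMFDerivAt.congr_mfderiv
      (ContinuousLinearMap.ext fun X ↦ congrArg Prod.snd (h5 X))

end TotalSpace

section Tangent

variable {E : Type*} [NormedAddCommGroup E] [NormedSpace ℝ E]
  {H : Type*} [TopologicalSpace H] {I : ModelWithCorners ℝ E H}
  {M : Type*} [TopologicalSpace M] [ChartedSpace H M] [IsManifold I 1 M]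

/-- On the fibre over `x` itself the preferred trivialization at `x` is the identity. -/
theorem trivializationAt_tangent_self (x : M) (v : TangentSpace I x) :
    (trivializationAt E (TangentSpace I) x ⟨x, v⟩).2 = v := by
  have h := congrArg (fun l ↦ l v)
    (TangentBundle.continuousLinearMapAt_trivializationAt (I := I) (mem_chart_source H x))
  rw [mfderiv_extChartAt_self] at h
  exact (congrFun (Trivialization.coe_linearMapAt_of_mem (R := ℝ) _
    (mem_baseSet_trivializationAt E _ x)) v).symm.trans h

theorem extend_tangent (x : M) (v : TangentSpace I x) (y : M) :
    FiberBundle.extend E v y = (trivializationAt E (TangentSpace I) x).symm y v := by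
  rw [FiberBundle.extend, trivializationAt_tangent_self]

/-- In the preferred chart at `x` there are affine maps with any prescribed value and derivative
at `x`. -/
theorem exists_contMDiffAt_hasMFDerivAt {F : Type*} [NormedAddCommGroup F] [NormedSpace ℝ F]
    {x : M} [IsManifold I ∞ M] (a : F) (B : TangentSpace I x →L[ℝ] F) :
    ∃ s : M → F, s x = a ∧ ContMDiffAt I 𝓘(ℝ, F) ∞ s x ∧ HasMFDerivAt I 𝓘(ℝ, F) s x B := by
  let B' : E →L[ℝ] F := B
  have hg : ContDiff ℝ ∞ fun z : E ↦ a + B' (z - extChartAt I x x) :=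
    contDiff_const.add (B'.contDiff.comp (contDiff_id.sub contDiff_const))
  have hg' : HasFDerivAt (fun z : E ↦ a + B' (z - extChartAt I x x)) B' (extChartAt I x x) :=
    (B'.hasFDerivAt.comp (extChartAt I x x)
      ((hasFDerivAt_id (extChartAt I x x)).sub_const (extChartAt I x x))).const_add a
  have hχ : HasMFDerivAt I 𝓘(ℝ, E) (extChartAt I x) x (ContinuousLinearMap.id ℝ E) :=
    (mdifferentiableAt_extChartAt (mem_chart_source _ x)).hasMFDerivAt.congr_mfderiv
      mfderiv_extChartAt_self
  refine ⟨fun y ↦ a + B' (extChartAt I x y - extChartAt I x x), by simp, ?_, ?_⟩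
  · exact hg.contMDiff.contMDiffAt.comp x contMDiffAt_extChartAt
  · exact hg'.comp_hasMFDerivAt hχ

/-- The Lie bracket in the coordinates of the preferred chart at the point where it is taken. -/
theorem mlieBracket_eq_of_coord [CompleteSpace E] {V W : ∀ y : M, TangentSpace I y} {x : M}
    {f g : M → E}
    {f' g' : TangentSpace I x →L[ℝ] E} (hf : HasMFDerivAt I 𝓘(ℝ, E) f x f')
    (hg : HasMFDerivAt I 𝓘(ℝ, E) g x g')
    (hV : ∀ᶠ y in 𝓝 x, (trivializationAt E (TangentSpace I) x ⟨y, V y⟩).2 = f y)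
    (hW : ∀ᶠ y in 𝓝 x, (trivializationAt E (TangentSpace I) x ⟨y, W y⟩).2 = g y) :
    VectorField.mlieBracket I V W x = (g' (f x) - f' (g x) : E) := by
  have key : ∀ (V : ∀ y : M, TangentSpace I y) (f : M → E),
      (∀ᶠ y in 𝓝 x, (trivializationAt E (TangentSpace I) x ⟨y, V y⟩).2 = f y) →
      VectorField.mpullbackWithin 𝓘(ℝ, E) I (extChartAt I x).symm V (Set.range I)
        =ᶠ[𝓝[Set.range I] (extChartAt I x x)] f ∘ (extChartAt I x).symm := by
    intro V f hV
    have hc := (continuousAt_extChartAt_symm (I := I) x)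
    rw [ContinuousAt, extChartAt_to_inv] at hc
    filter_upwards [(hc.mono_left nhdsWithin_le_nhds).eventually hV,
      extChartAt_target_mem_nhdsWithin x] with z hz hzt
    rw [VectorField.mpullbackWithin_apply, Function.comp_apply, ← hz]
    have hs : (extChartAt I x).symm z ∈ (chartAt H x).source := by
      have := (extChartAt I x).map_target hzt
      rwa [extChartAt_source] at this
    have h1 := TangentBundle.continuousLinearMapAt_trivializationAt (I := I) hs
    have h2 : (mfderivWithin 𝓘(ℝ, E) I (extChartAt I x).symm (Set.range I) z).inverse
        = mfderiv I 𝓘(ℝ, E) (extChartAt I x) ((extChartAt I x).symm z) :=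
      ContinuousLinearMap.inverse_eq
        (mfderivWithin_extChartAt_symm_comp_mfderiv_extChartAt hzt)
        (mfderiv_extChartAt_comp_mfderivWithin_extChartAt_symm hzt)
    rw [h2]
    have h3 := congrArg (fun l ↦ l (V ((extChartAt I x).symm z))) h1
    exact h3.symm.trans (congrFun (Trivialization.coe_linearMapAt_of_mem (R := ℝ) _
      (by exact hs)) _)
  have hfx : f ((extChartAt I x).symm (extChartAt I x x)) = f x := by rw [extChartAt_to_inv]
  have hgx : g ((extChartAt I x).symm (extChartAt I x x)) = g x := by rw [extChartAt_to_inv]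
  have hu : UniqueDiffWithinAt ℝ (Set.range I) (extChartAt I x x) :=
    I.uniqueDiffOn.uniqueDiffWithinAt (Set.mem_range_self _)
  rw [VectorField.mlieBracket, VectorField.mlieBracketWithin_apply, mfderiv_extChartAt_self]
  have h := ((key V f hV).lieBracketWithin_vectorField_eq_of_mem (key W g hW)
    (Set.mem_range_self _)  (𝕜 := ℝ))
  rw [Set.preimage_univ, Set.univ_inter]
  have hi : (ContinuousLinearMap.id ℝ E).inverse = ContinuousLinearMap.id ℝ E :=
    ContinuousLinearMap.inverse_id
  refine (DFunLike.congr_fun hi _).trans (h.trans ?_)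
  rw [VectorField.lieBracketWithin]
  have e1 : fderivWithin ℝ (f ∘ (extChartAt I x).symm) (Set.range I) (extChartAt I x x) = f' :=
    HasFDerivWithinAt.fderivWithin (f' := (f' : E →L[ℝ] E)) hf.2 hu
  have e2 : fderivWithin ℝ (g ∘ (extChartAt I x).symm) (Set.range I) (extChartAt I x x) = g' :=
    HasFDerivWithinAt.fderivWithin (f' := (g' : E →L[ℝ] E)) hg.2 hu
  rw [e1, e2, Function.comp_apply, Function.comp_apply, hfx, hgx]
  rfl

end Tangent

namespace AlmostHermitian

/-! ### The Koszul formula in a fixed inner product space -/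

/-- A continuous trilinear form, regarded as a linear one. -/
def trilinear {E : Type*} [NormedAddCommGroup E] [NormedSpace ℝ E]
    (D : E →L[ℝ] E →L[ℝ] E →L[ℝ] ℝ) : E →ₗ[ℝ] E →ₗ[ℝ] E →ₗ[ℝ] ℝ :=
  LinearMap.mk₂ ℝ (fun v a ↦ (D v a).toLinearMap)
    (fun u v a ↦ LinearMap.ext fun c ↦ by rw [D.map_add]; rfl)
    (fun r v a ↦ LinearMap.ext fun c ↦ by rw [D.map_smul]; rfl)
    (fun u v a ↦ LinearMap.ext fun c ↦ by rw [(D u).map_add]; rfl)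
    (fun r v a ↦ LinearMap.ext fun c ↦ by rw [(D v).map_smul]; rfl)

section Koszul

variable {ι V : Type*} [Fintype ι] [NormedAddCommGroup V] [InnerProductSpace ℝ V]

theorem _root_.OrthonormalBasis.inner_sum_apply_smul (b : OrthonormalBasis ι ℝ V) (f : V →ₗ[ℝ] ℝ)
    (c : V) : inner ℝ (∑ i, f (b i) • b i) c = f c := by
  conv_rhs => rw [← b.sum_repr c]
  simp only [sum_inner, inner_smul_left, map_sum, map_smul, b.repr_apply_apply, smul_eq_mul,
    RCLike.conj_to_real]
  exact Finset.sum_congr rfl fun i _ ↦ mul_comm _ _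

/-- The functional `c ↦ ½ (D_v g(a, c) + D_a g(v, c) - D_c g(v, a))` of the Koszul formula, for the
derivative `D` of a metric `g`. -/
def koszulForm (D : V →ₗ[ℝ] V →ₗ[ℝ] V →ₗ[ℝ] ℝ) (v a : V) : V →ₗ[ℝ] ℝ :=
  (1 / 2 : ℝ) • (D v a + D a v - (D.flip v).flip a)

theorem koszulForm_apply (D : V →ₗ[ℝ] V →ₗ[ℝ] V →ₗ[ℝ] ℝ) (v a c : V) :
    koszulForm D v a c = (1 / 2 : ℝ) * (D v a c + D a v c - D c v a) := rfl

/-- The bilinear map with `⟨Γ(v, a), c⟩ = ½ (D_v g(a, c) + D_a g(v, c) - D_c g(v, a))`. -/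
def _root_.OrthonormalBasis.koszulMap (b : OrthonormalBasis ι ℝ V)
    (D : V →ₗ[ℝ] V →ₗ[ℝ] V →ₗ[ℝ] ℝ) : V →ₗ[ℝ] V →ₗ[ℝ] V :=
  LinearMap.mk₂ ℝ (fun v a ↦ ∑ i, koszulForm D v a (b i) • b i)
    (fun u v a ↦ by
      simp only [koszulForm_apply, map_add, LinearMap.add_apply, ← Finset.sum_add_distrib,
        ← add_smul]
      exact Finset.sum_congr rfl fun i _ ↦ by congr 1; ring)
    (fun r v a ↦ by
      simp only [koszulForm_apply, map_smul, LinearMap.smul_apply, Finset.smul_sum, smul_smul,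
        smul_eq_mul]
      exact Finset.sum_congr rfl fun i _ ↦ by congr 1; ring)
    (fun u v a ↦ by
      simp only [koszulForm_apply, map_add, LinearMap.add_apply, ← Finset.sum_add_distrib,
        ← add_smul]
      exact Finset.sum_congr rfl fun i _ ↦ by congr 1; ring)
    (fun r v a ↦ by
      simp only [koszulForm_apply, map_smul, LinearMap.smul_apply, Finset.smul_sum, smul_smul,
        smul_eq_mul]
      exact Finset.sum_congr rfl fun i _ ↦ by congr 1; ring)

theorem _root_.OrthonormalBasis.inner_koszulMap (b : OrthonormalBasis ι ℝ V)
    (D : V →ₗ[ℝ] V →ₗ[ℝ] V →ₗ[ℝ] ℝ) (v a c : V) :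
    inner ℝ (b.koszulMap D v a) c = (1 / 2 : ℝ) * (D v a c + D a v c - D c v a) :=
  b.inner_sum_apply_smul (koszulForm D v a) c

variable {D : V →ₗ[ℝ] V →ₗ[ℝ] V →ₗ[ℝ] ℝ}

theorem _root_.OrthonormalBasis.koszulMap_symm (b : OrthonormalBasis ι ℝ V)
    (hD : ∀ v a c, D v a c = D v c a) (v a : V) : b.koszulMap D v a = b.koszulMap D a v := by
  refine ext_inner_right ℝ fun c ↦ ?_
  rw [b.inner_koszulMap, b.inner_koszulMap, hD c v a]
  ring

theorem _root_.OrthonormalBasis.eq_inner_koszulMap_add (b : OrthonormalBasis ι ℝ V)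
    (hD : ∀ v a c, D v a c = D v c a) (v a c : V) :
    D v a c = inner ℝ (b.koszulMap D v a) c + inner ℝ a (b.koszulMap D v c) := by
  rw [real_inner_comm _ a, b.inner_koszulMap, b.inner_koszulMap, hD v c a, hD c v a, hD a v c]
  ring

end Koszul

/-! ### The Levi-Civita connection in coordinates -/

section LeviCivita

set_option synthInstance.maxHeartbeats 200000

variable {n : ℕ} {M : Type*} [TopologicalSpace M] [ChartedSpace (Model n) M]
  [IsManifold (𝓡 (2 * n)) ∞ M]

instance (x : M) : FiniteDimensional ℝ (TangentSpace (𝓡 (2 * n)) x) :=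
  inferInstanceAs (FiniteDimensional ℝ (Model n))

/-- The coordinate expression of a tangent vector at `y` in the trivialization of the tangent bundle
at `x`; junk unless `y` is close to `x`. -/
def coord (x : M) {y : M} (v : TangentSpace (𝓡 (2 * n)) y) : Model n :=
  (trivializationAt (Model n) (TangentSpace (𝓡 (2 * n))) x ⟨y, v⟩).2

/-- The open set of points at which the trivialization of the tangent bundle at `x` is defined. -/
def coordDomain (n : ℕ) {M : Type*} [TopologicalSpace M] [ChartedSpace (Model n) M]
    [IsManifold (𝓡 (2 * n)) ∞ M] (x : M) : Set M :=
  (trivializationAt (Model n) (TangentSpace (𝓡 (2 * n)) : M → Type _) x).baseSet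

theorem mem_coordDomain (x : M) : x ∈ coordDomain n x := mem_baseSet_trivializationAt _ _ x

theorem coordDomain_mem_nhds (x : M) : coordDomain n x ∈ 𝓝 x :=
  (trivializationAt (Model n) (TangentSpace (𝓡 (2 * n))) x).open_baseSet.mem_nhds
    (mem_coordDomain x)

/-- The coordinate expression of tangent vectors as a linear equivalence. -/
def coordEquiv {x y : M} (hy : y ∈ coordDomain n x) :
    TangentSpace (𝓡 (2 * n)) y ≃L[ℝ] Model n :=
  (trivializationAt (Model n) (TangentSpace (𝓡 (2 * n))) x).continuousLinearEquivAt ℝ y hy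

theorem coordEquiv_apply {x y : M} (hy : y ∈ coordDomain n x) (v : TangentSpace (𝓡 (2 * n)) y) :
    coordEquiv hy v = coord x v := rfl

theorem coord_self (x : M) (v : TangentSpace (𝓡 (2 * n)) x) : coord x v = v :=
  trivializationAt_tangent_self x v

theorem extend_eq_coordEquiv_symm {x y : M} (hy : y ∈ coordDomain n x)
    (v : TangentSpace (𝓡 (2 * n)) x) :
    FiberBundle.extend (Model n) v y = (coordEquiv hy).symm v :=
  extend_tangent x v y

theorem coord_extend {x y : M} (hy : y ∈ coordDomain n x) (v : TangentSpace (𝓡 (2 * n)) x) :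
    coord x (FiberBundle.extend (Model n) v y) = v := by
  rw [extend_eq_coordEquiv_symm hy]
  exact (coordEquiv hy).apply_symm_apply v

variable [RiemannianBundle (fun x : M ↦ TangentSpace (𝓡 (2 * n)) x)]
  [IsContMDiffRiemannianBundle (𝓡 (2 * n)) ∞ (Model n) (fun x : M ↦ TangentSpace (𝓡 (2 * n)) x)]

/-- The metric is differentiable in the trivialization at `x`. -/
theorem exists_metricCoord (x : M) :
    ∃ G : M → Model n →L[ℝ] Model n →L[ℝ] ℝ,
      MDifferentiableAt (𝓡 (2 * n)) 𝓘(ℝ, Model n →L[ℝ] Model n →L[ℝ] ℝ) G x ∧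
      ∀ y ∈ coordDomain n x, ∀ v w : TangentSpace (𝓡 (2 * n)) y,
        inner ℝ v w = G y (coord x v) (coord x w) := by
  obtain ⟨g, hg, hgi⟩ := IsContMDiffRiemannianBundle.exists_contMDiff
    (IB := 𝓡 (2 * n)) (n := ∞) (F := Model n) (E := fun x : M ↦ TangentSpace (𝓡 (2 * n)) x)
  refine ⟨fun y ↦ ContinuousLinearMap.inCoordinates (Model n) (TangentSpace (𝓡 (2 * n)))
    (Model n →L[ℝ] ℝ) (fun y : M ↦ TangentSpace (𝓡 (2 * n)) y →L[ℝ] Bundle.Trivial M ℝ y)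
    x y x y (g y), ?_, ?_⟩
  · have h := (hg x).mdifferentiableAt (by simp)
    exact ((mdifferentiableAt_hom_bundle _).1 h).2
  · intro y hy v w
    rw [hgi y v w]
    have h := inCoordinates_apply_eq₂ (𝕜 := ℝ) (F₁ := Model n) (F₂ := Model n) (F₃ := ℝ)
      (E₁ := (TangentSpace (𝓡 (2 * n)) : M → Type _))
      (E₂ := (TangentSpace (𝓡 (2 * n)) : M → Type _)) (E₃ := Bundle.Trivial M ℝ)
      (x₀ := x) (x := y) (ϕ := g y) (v := coord x v) (w := coord x w) hy hy (Set.mem_univ _)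
    refine Eq.trans ?_ h.symm
    have e : ∀ u : TangentSpace (𝓡 (2 * n)) y,
        (trivializationAt (Model n) (TangentSpace (𝓡 (2 * n))) x).symm y (coord x u) = u :=
      fun u ↦ (coordEquiv hy).symm_apply_apply u
    rw [e, e]
    simp

/-- The metric in the coordinates of the trivialization at `x`, as a field of bilinear forms
near `x`. -/
def metricCoord (x : M) : M → Model n →L[ℝ] Model n →L[ℝ] ℝ := (exists_metricCoord x).choose

theorem mdifferentiableAt_metricCoord (x : M) :
    MDifferentiableAt (𝓡 (2 * n)) 𝓘(ℝ, Model n →L[ℝ] Model n →L[ℝ] ℝ) (metricCoord (n := n) x) x :=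
  (exists_metricCoord x).choose_spec.1

theorem inner_eq_metricCoord {x y : M} (hy : y ∈ coordDomain n x)
    (v w : TangentSpace (𝓡 (2 * n)) y) : inner ℝ v w = metricCoord x y (coord x v) (coord x w) :=
  (exists_metricCoord x).choose_spec.2 y hy v w

theorem metricCoord_self (x : M) (v w : TangentSpace (𝓡 (2 * n)) x) :
    metricCoord x x v w = inner ℝ v w := by
  rw [inner_eq_metricCoord (mem_coordDomain x), coord_self, coord_self]

/-- The derivative at `x` of the coordinate expression of the metric. -/
def metricDerivL (x : M) : Model n →L[ℝ] Model n →L[ℝ] Model n →L[ℝ] ℝ :=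
  mvfderiv (𝓡 (2 * n)) (metricCoord x) x

theorem hasMFDerivAt_metricCoord (x : M) :
    HasMFDerivAt (𝓡 (2 * n)) 𝓘(ℝ, Model n →L[ℝ] Model n →L[ℝ] ℝ) (metricCoord (n := n) x) x
      (metricDerivL x) :=
  (mdifferentiableAt_metricCoord x).hasMFDerivAt

theorem metricDerivL_symm (x : M) (v a b : Model n) :
    metricDerivL x v a b = metricDerivL x v b a := by
  have h : ∀ a b : Model n, HasMFDerivAt (𝓡 (2 * n)) 𝓘(ℝ, ℝ) (fun y ↦ metricCoord x y a b) x
      ((ContinuousLinearMap.apply ℝ ℝ b ∘L ContinuousLinearMap.apply ℝ (Model n →L[ℝ] ℝ) a) ∘L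
        metricDerivL x) := fun a b ↦
    (ContinuousLinearMap.apply ℝ ℝ b ∘L ContinuousLinearMap.apply ℝ (Model n →L[ℝ] ℝ) a
      ).comp_hasMFDerivAt (hasMFDerivAt_metricCoord x)
  have hs : (fun y ↦ metricCoord x y a b) =ᶠ[𝓝 x] fun y ↦ metricCoord x y b a := by
    filter_upwards [coordDomain_mem_nhds (n := n) x] with y hy
    have h1 := inner_eq_metricCoord hy ((coordEquiv hy).symm a) ((coordEquiv hy).symm b)
    have h2 := inner_eq_metricCoord hy ((coordEquiv hy).symm b) ((coordEquiv hy).symm a)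
    simp only [← coordEquiv_apply hy, ContinuousLinearEquiv.apply_symm_apply] at h1 h2
    rw [← h1, ← h2, real_inner_comm]
  exact DFunLike.congr_fun (hasMFDerivAt_unique (h a b) ((h b a).congr_of_eventuallyEq hs)) v

/-- The derivative of the metric, with the coordinate space identified with the tangent space
at `x`. -/
def metricDeriv (x : M) : TangentSpace (𝓡 (2 * n)) x →ₗ[ℝ] TangentSpace (𝓡 (2 * n)) x →ₗ[ℝ]
    TangentSpace (𝓡 (2 * n)) x →ₗ[ℝ] ℝ :=
  trilinear (metricDerivL x)

theorem metricDeriv_symm (x : M) (v a b : TangentSpace (𝓡 (2 * n)) x) :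
    metricDeriv x v a b = metricDeriv x v b a :=
  metricDerivL_symm x v a b

/-- The Christoffel symbol `Γ(v, a)` of the Levi-Civita connection at `x`, in the coordinates of the
trivialization at `x`. -/
def christoffel (x : M) : TangentSpace (𝓡 (2 * n)) x →ₗ[ℝ] TangentSpace (𝓡 (2 * n)) x →ₗ[ℝ]
    TangentSpace (𝓡 (2 * n)) x :=
  (stdOrthonormalBasis ℝ (TangentSpace (𝓡 (2 * n)) x)).koszulMap (metricDeriv x)

theorem christoffel_symm (x : M) (v a : TangentSpace (𝓡 (2 * n)) x) :
    christoffel x v a = christoffel x a v :=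
  OrthonormalBasis.koszulMap_symm _ (metricDeriv_symm x) v a

/-- The Levi-Civita connection is metric. -/
theorem metricDeriv_eq (x : M) (v a b : TangentSpace (𝓡 (2 * n)) x) :
    metricDeriv x v a b = inner ℝ (christoffel x v a) b + inner ℝ a (christoffel x v b) :=
  OrthonormalBasis.eq_inner_koszulMap_add _ (metricDeriv_symm x) v a b

/-- The product rule for the inner product of two vector fields along a map `f`, in terms of the
coordinate expressions of the fields at `x = f p`. -/
theorem mvfderiv_inner {EN : Type*} [NormedAddCommGroup EN] [NormedSpace ℝ EN]
    {HN : Type*} [TopologicalSpace HN] {IN : ModelWithCorners ℝ EN HN}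
    {N : Type*} [TopologicalSpace N] [ChartedSpace HN N] {x : M} {p : N} {f : N → M}
    (hfp : f p = x) {f' : TangentSpace IN p →L[ℝ] TangentSpace (𝓡 (2 * n)) x}
    (hf : HasMFDerivAt IN (𝓡 (2 * n)) f p f') {u w : ∀ q, TangentSpace (𝓡 (2 * n)) (f q)}
    {a b : N → Model n} {a' b' : TangentSpace IN p →L[ℝ] TangentSpace (𝓡 (2 * n)) x}
    (ha : HasMFDerivAt IN 𝓘(ℝ, Model n) a p a') (hb : HasMFDerivAt IN 𝓘(ℝ, Model n) b p b')
    (hu : ∀ᶠ q in 𝓝 p, coord x (u q) = a q) (hw : ∀ᶠ q in 𝓝 p, coord x (w q) = b q)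
    {a₀ b₀ : TangentSpace (𝓡 (2 * n)) x} (ha₀ : a p = a₀) (hb₀ : b p = b₀)
    (X : TangentSpace IN p) :
    mvfderiv IN (fun q ↦ inner ℝ (u q) (w q)) p X =
      inner ℝ (a' X + christoffel x (f' X) a₀) b₀ +
        inner ℝ a₀ (b' X + christoffel x (f' X) b₀) := by
  subst hfp
  have hG : HasMFDerivAt IN 𝓘(ℝ, Model n →L[ℝ] Model n →L[ℝ] ℝ)
      (metricCoord (f p) ∘ f) p ((metricDerivL (f p)).comp f') :=
    HasMFDerivAt.comp (x := p) (hasMFDerivAt_metricCoord (f p)) hf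
  have hprod := (ContinuousLinearMap.id ℝ (Model n →L[ℝ] ℝ)).hasMFDerivAt_of_bilinear
    ((ContinuousLinearMap.id ℝ (Model n →L[ℝ] Model n →L[ℝ] ℝ)).hasMFDerivAt_of_bilinear hG ha) hb
  have he : (fun q ↦ inner ℝ (u q) (w q)) =ᶠ[𝓝 p]
      fun q ↦ (metricCoord (f p) ∘ f) q (a q) (b q) := by
    filter_upwards [hu, hw, hf.1 (coordDomain_mem_nhds (n := n) (f p))] with q h1 h2 h3
    rw [inner_eq_metricCoord h3, h1, h2]
    rfl
  have h := (hprod.congr_of_eventuallyEq he).mfderiv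
  have h' : mvfderiv IN (fun q ↦ inner ℝ (u q) (w q)) p X =
      inner ℝ a₀ (b' X) + (inner ℝ (a' X) b₀ + metricDeriv (f p) (f' X) a₀ b₀) := by
    subst ha₀ hb₀
    exact (DFunLike.congr_fun h X).trans (congrArg₂ (· + ·) (metricCoord_self (f p) (a p) (b' X))
      (congrArg (· + metricDeriv (f p) (f' X) (a p) (b p)) (metricCoord_self (f p) (a' X) (b p))))
  rw [h', inner_add_left, inner_add_right, metricDeriv_eq]
  ring

end LeviCivita

section Covariant

set_option synthInstance.maxHeartbeats 200000

variable {n : ℕ} {M : Type*} [TopologicalSpace M] [ChartedSpace (Model n) M]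

/-- A map with constant value in the model space, with both sides of the derivative regarded as
tangent spaces of `M`. -/
theorem hasMFDerivAt_const_model (x : M) (v : Model n) :
    HasMFDerivAt (𝓡 (2 * n)) 𝓘(ℝ, Model n) (fun _ : M ↦ v) x
      (0 : TangentSpace (𝓡 (2 * n)) x →L[ℝ] TangentSpace (𝓡 (2 * n)) x) :=
  hasMFDerivAt_const v x

variable [IsManifold (𝓡 (2 * n)) ∞ M]

theorem eventually_coord_extend {x : M} (v : TangentSpace (𝓡 (2 * n)) x) :
    ∀ᶠ y in 𝓝 x, coord x (FiberBundle.extend (Model n) v y) = v :=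
  Filter.mem_of_superset (coordDomain_mem_nhds (n := n) x) fun _ hy ↦ coord_extend hy v

variable [RiemannianBundle (fun x : M ↦ TangentSpace (𝓡 (2 * n)) x)]
  [IsContMDiffRiemannianBundle (𝓡 (2 * n)) ∞ (Model n) (fun x : M ↦ TangentSpace (𝓡 (2 * n)) x)]

/-- The Koszul formula, evaluated on the extensions `v`, `c` that are constant in the coordinates
at `x`. -/
theorem koszul_extend {x : M} {Y : ∀ y : M, TangentSpace (𝓡 (2 * n)) y} {a : M → Model n}
    {a' : TangentSpace (𝓡 (2 * n)) x →L[ℝ] TangentSpace (𝓡 (2 * n)) x}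
    (ha : HasMFDerivAt (𝓡 (2 * n)) 𝓘(ℝ, Model n) a x a')
    (hY : ∀ᶠ y in 𝓝 x, coord x (Y y) = a y) (v c : TangentSpace (𝓡 (2 * n)) x) :
    koszul (FiberBundle.extend (Model n) v) Y (FiberBundle.extend (Model n) c) x =
      2 * inner ℝ (a' v + christoffel x v (Y x)) c := by
  have haY : a x = Y x := hY.self_of_nhds.symm.trans (coord_self x (Y x))
  have hid := hasMFDerivAt_id (I := 𝓡 (2 * n)) x
  have hv := hasMFDerivAt_const_model x v
  have hc := hasMFDerivAt_const_model x c
  have hv' := eventually_coord_extend v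
  have hc' := eventually_coord_extend c
  have e1 := mvfderiv_inner (x := x) rfl hid ha hc hY hc' haY rfl v
  have e2 := mvfderiv_inner (x := x) rfl hid hv hc hv' hc' rfl rfl (Y x)
  have e3 := mvfderiv_inner (x := x) rfl hid hv ha hv' hY rfl haY c
  have b1 : VectorField.mlieBracket (𝓡 (2 * n)) (FiberBundle.extend (Model n) v) Y x = a' v :=
    (mlieBracket_eq_of_coord hv ha hv' hY).trans (sub_zero (a' v))
  have b2 : VectorField.mlieBracket (𝓡 (2 * n)) (FiberBundle.extend (Model n) v)
      (FiberBundle.extend (Model n) c) x = 0 :=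
    (mlieBracket_eq_of_coord hv hc hv' hc').trans (sub_zero (0 : TangentSpace (𝓡 (2 * n)) x))
  have b3 : VectorField.mlieBracket (𝓡 (2 * n)) Y (FiberBundle.extend (Model n) c) x = -a' c :=
    (mlieBracket_eq_of_coord ha hc hY hc').trans (zero_sub (a' c))
  simp only [koszul, FiberBundle.extend_apply_self, b1, b2, b3]
  erw [e1, e2, e3]
  simp only [_root_.zero_apply, zero_add, ContinuousLinearMap.id_apply,
    inner_add_left, inner_add_right, inner_neg_left, inner_zero_left]
  rw [christoffel_symm x (Y x) v, christoffel_symm x c v, christoffel_symm x (Y x) c,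
    real_inner_comm (Y x), real_inner_comm v (a' c)]
  ring

/-- The Levi-Civita covariant derivative in coordinates. -/
theorem leviCivita_eq {x : M} {Y : ∀ y : M, TangentSpace (𝓡 (2 * n)) y} {a : M → Model n}
    {a' : TangentSpace (𝓡 (2 * n)) x →L[ℝ] TangentSpace (𝓡 (2 * n)) x}
    (ha : HasMFDerivAt (𝓡 (2 * n)) 𝓘(ℝ, Model n) a x a')
    (hY : ∀ᶠ y in 𝓝 x, coord x (Y y) = a y) (v : TangentSpace (𝓡 (2 * n)) x) :
    leviCivita Y x v = a' v + christoffel x v (Y x) := by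
  simp only [leviCivita, koszul_extend ha hY v]
  refine ext_inner_right ℝ fun c ↦ ?_
  refine Eq.trans ?_ ((stdOrthonormalBasis ℝ (TangentSpace (𝓡 (2 * n)) x)).inner_sum_apply_smul
    (innerSL ℝ (a' v + christoffel x v (Y x))).toLinearMap c)
  congr 1
  refine Finset.sum_congr rfl fun A _ ↦ ?_
  rw [← mul_assoc, one_div, inv_mul_cancel₀ two_ne_zero, one_mul]
  rfl

end Covariant

/-! ### Frames and endomorphisms in coordinates -/

section Coordinates

set_option synthInstance.maxHeartbeats 200000

variable {n : ℕ} {M : Type*} [TopologicalSpace M] [ChartedSpace (Model n) M]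
  [IsManifold (𝓡 (2 * n)) ∞ M]

/-- The coordinate expression of a frame in the trivialization at `x`. -/
def frameCoord (x : M) (f : FrameSpace n M) : R2n n →L[ℝ] Model n :=
  (trivializationAt (R2n n →L[ℝ] Model n)
    (fun x : M ↦ Bundle.Trivial M (R2n n) x →L[ℝ] TangentSpace (𝓡 (2 * n)) x) x f).2

/-- The coordinate expression of an endomorphism of a tangent space in the trivialization at `x`. -/
def endCoord (x : M) (j : EndSpace n M) : Model n →L[ℝ] Model n :=
  (trivializationAt (Model n →L[ℝ] Model n)
    (fun x : M ↦ TangentSpace (𝓡 (2 * n)) x →L[ℝ] TangentSpace (𝓡 (2 * n)) x) x j).2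

theorem frameCoord_apply {x : M} {f : FrameSpace n M} (hf : f.proj ∈ coordDomain n x) (u : R2n n) :
    frameCoord x f u = coord x (f.snd u) := by
  have h := hom_trivializationAt_apply (σ := RingHom.id ℝ) (F₁ := R2n n)
    (E₁ := Bundle.Trivial M (R2n n)) (F₂ := Model n)
    (E₂ := (TangentSpace (𝓡 (2 * n)) : M → Type _)) x f
  have h1 : frameCoord x f = _ := congrArg Prod.snd h
  rw [h1]
  refine (DFunLike.congr_fun (ContinuousLinearMap.inCoordinates_eq (Set.mem_univ _) hf) u).trans ?_
  refine congrArg (fun w ↦ coord x (f.snd w)) ?_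
  exact ContinuousLinearEquiv.symm_apply_apply
    ((trivializationAt (R2n n) (Bundle.Trivial M (R2n n)) x).continuousLinearEquivAt ℝ f.proj
      (Set.mem_univ _)) u

theorem endCoord_apply {x : M} {j : EndSpace n M} (hj : j.proj ∈ coordDomain n x)
    (u : TangentSpace (𝓡 (2 * n)) j.proj) :
    endCoord x j (coord x u) = coord x (j.snd u) := by
  have h := hom_trivializationAt_apply (σ := RingHom.id ℝ) (F₁ := Model n)
    (E₁ := (TangentSpace (𝓡 (2 * n)) : M → Type _)) (F₂ := Model n)
    (E₂ := (TangentSpace (𝓡 (2 * n)) : M → Type _)) x j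
  have h1 : endCoord x j = _ := congrArg Prod.snd h
  rw [h1]
  refine (DFunLike.congr_fun (ContinuousLinearMap.inCoordinates_eq hj hj) (coord x u)).trans ?_
  refine congrArg (fun w ↦ coord x (j.snd w)) ?_
  exact (coordEquiv hj).symm_apply_apply u

theorem frameCoord_self (e : FrameSpace n M) : frameCoord e.proj e = e.snd :=
  ContinuousLinearMap.ext fun u ↦ (frameCoord_apply (mem_coordDomain e.proj) u).trans
    (coord_self e.proj (e.snd u))

theorem endCoord_self (j : EndSpace n M) : endCoord j.proj j = j.snd :=
  ContinuousLinearMap.ext fun u ↦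
    (congrArg (endCoord j.proj j) (coord_self j.proj u)).symm.trans
    ((endCoord_apply (mem_coordDomain j.proj) u).trans (coord_self j.proj (j.snd u)))

theorem hasMFDerivAt_frameCoord (e : FrameSpace n M) :
    HasMFDerivAt (frameModel n) 𝓘(ℝ, R2n n →L[ℝ] Model n) (frameCoord e.proj) e
      (ContinuousLinearMap.snd ℝ (Model n) (R2n n →L[ℝ] Model n)) :=
  (hasMFDerivAt_totalSpace_proj_coord (IB := 𝓡 (2 * n)) e).2

theorem hasMFDerivAt_frame_proj (e : FrameSpace n M) :
    HasMFDerivAt (frameModel n) (𝓡 (2 * n)) (fun f : FrameSpace n M ↦ f.proj) e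
      (ContinuousLinearMap.fst ℝ (Model n) (R2n n →L[ℝ] Model n)) :=
  (hasMFDerivAt_totalSpace_proj_coord (IB := 𝓡 (2 * n)) e).1

/-- The tangent vector of the space of frames with base component `v` and fibre component `a` in the
trivialization at the base point. -/
def frameTangent (e : FrameSpace n M) (v : TangentSpace (𝓡 (2 * n)) e.proj)
    (a : R2n n →L[ℝ] TangentSpace (𝓡 (2 * n)) e.proj) : TangentSpace (frameModel n) e :=
  ((v, a) : Model n × (R2n n →L[ℝ] Model n))

/-- The tangent vector of the space of endomorphisms with base component `v` and fibre component
`b` in the trivialization at the base point. -/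
def endTangent (j : EndSpace n M) (v : TangentSpace (𝓡 (2 * n)) j.proj)
    (b : TangentSpace (𝓡 (2 * n)) j.proj →L[ℝ] TangentSpace (𝓡 (2 * n)) j.proj) :
    TangentSpace (endModel n) j :=
  ((v, b) : Model n × (Model n →L[ℝ] Model n))

theorem exists_eq_frameTangent (e : FrameSpace n M) (X : TangentSpace (frameModel n) e) :
    ∃ v a, X = frameTangent e v a := ⟨X.1, X.2, rfl⟩

theorem frameTangent_sub (e : FrameSpace n M) (v w : TangentSpace (𝓡 (2 * n)) e.proj)
    (a b : R2n n →L[ℝ] TangentSpace (𝓡 (2 * n)) e.proj) :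
    frameTangent e v a - frameTangent e w b = frameTangent e (v - w) (a - b) := rfl

theorem frameTangent_inj {e : FrameSpace n M} {v w : TangentSpace (𝓡 (2 * n)) e.proj}
    {a b : R2n n →L[ℝ] TangentSpace (𝓡 (2 * n)) e.proj}
    (h : frameTangent e v a = frameTangent e w b) : v = w ∧ a = b :=
  ⟨congrArg Prod.fst h, congrArg Prod.snd h⟩

theorem endTangent_inj {j : EndSpace n M} {v w : TangentSpace (𝓡 (2 * n)) j.proj}
    {a b : TangentSpace (𝓡 (2 * n)) j.proj →L[ℝ] TangentSpace (𝓡 (2 * n)) j.proj}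
    (h : endTangent j v a = endTangent j w b) : v = w ∧ a = b :=
  ⟨congrArg Prod.fst h, congrArg Prod.snd h⟩

/-- The fundamental vector field is vertical, with fibre component `e ∘ l`. -/
theorem fundamental_eq (e : FrameSpace n M) (l : End2n n) :
    fundamental e l = frameTangent e 0 (e.snd ∘L l) := by
  have h0 : HasDerivAt (fun t : ℝ ↦ NormedSpace.exp (t • l)) l 0 := by
    have h := hasDerivAt_exp_smul_const (𝕂 := ℝ) l (0 : ℝ)
    rwa [zero_smul ℝ l, NormedSpace.exp_zero, one_mul] at h
  let L : R2n n →L[ℝ] Model n := e.snd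
  have h1 : HasFDerivAt (fun t : ℝ ↦ L ∘L NormedSpace.exp (t • l))
      (((ContinuousLinearMap.compL ℝ (R2n n) (R2n n) (Model n)) L) ∘L
        (ContinuousLinearMap.toSpanSingleton ℝ l)) 0 :=
    ((ContinuousLinearMap.compL ℝ (R2n n) (R2n n) (Model n)) L).hasFDerivAt.comp 0 h0.hasFDerivAt
  have h2 := HasMFDerivAt.totalSpace (IB := 𝓡 (2 * n)) (f := fun t : ℝ ↦ (⟨e.proj,
    ContinuousLinearMap.comp (e.snd : R2n n →L[ℝ] TangentSpace (𝓡 (2 * n)) e.proj)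
      (NormedSpace.exp (t • l))⟩ : FrameSpace n M)) (p := 0)
    (hasMFDerivAt_const (I := 𝓘(ℝ, ℝ)) e.proj (0 : ℝ))
    (h1.hasMFDerivAt.congr_of_eventuallyEq (Eventually.of_forall fun t ↦
      frameCoord_self (⟨e.proj, ContinuousLinearMap.comp
        (e.snd : R2n n →L[ℝ] TangentSpace (𝓡 (2 * n)) e.proj)
          (NormedSpace.exp (t • l))⟩ : FrameSpace n M)))
  refine (DFunLike.congr_fun h2.mfderiv (1 : ℝ)).trans ?_
  have h3 : ((ContinuousLinearMap.compL ℝ (R2n n) (R2n n) (Model n)) L ∘L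
      (ContinuousLinearMap.toSpanSingleton ℝ l)) (1 : ℝ) = L ∘L l := by simp
  exact congrArg (Prod.mk (0 : Model n)) h3

/-- The derivative of a frame field, in coordinates. -/
theorem mfderiv_frameField {x : M}
    {s : ∀ y : M, Bundle.Trivial M (R2n n) y →L[ℝ] TangentSpace (𝓡 (2 * n)) y}
    {s' : TangentSpace (𝓡 (2 * n)) x →L[ℝ] R2n n →L[ℝ] Model n}
    (hs : HasMFDerivAt (𝓡 (2 * n)) 𝓘(ℝ, R2n n →L[ℝ] Model n)
      (fun y ↦ frameCoord x (⟨y, s y⟩ : FrameSpace n M)) x s')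
    (v : TangentSpace (𝓡 (2 * n)) x) :
    mfderiv (𝓡 (2 * n)) (frameModel n) (fun y ↦ (⟨y, s y⟩ : FrameSpace n M)) x v =
      frameTangent ⟨x, s x⟩ v (s' v) := by
  have h := HasMFDerivAt.totalSpace (f := fun y ↦ (⟨y, s y⟩ : FrameSpace n M))
    (hasMFDerivAt_id (I := 𝓡 (2 * n)) x) hs
  exact DFunLike.congr_fun h.mfderiv v

/-- The derivative of a field of endomorphisms, in coordinates. -/
theorem mfderiv_endField {x : M}
    {J : ∀ y : M, TangentSpace (𝓡 (2 * n)) y →L[ℝ] TangentSpace (𝓡 (2 * n)) y}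
    {J' : TangentSpace (𝓡 (2 * n)) x →L[ℝ] Model n →L[ℝ] Model n}
    (hJ : HasMFDerivAt (𝓡 (2 * n)) 𝓘(ℝ, Model n →L[ℝ] Model n)
      (fun y ↦ endCoord x (endSection J y)) x J')
    (v : TangentSpace (𝓡 (2 * n)) x) :
    mfderiv (𝓡 (2 * n)) (endModel n) (endSection J) x v =
      endTangent (endSection J x) v (J' v) := by
  have h := HasMFDerivAt.totalSpace (f := endSection J)
    (hasMFDerivAt_id (I := 𝓡 (2 * n)) x) hJ
  exact DFunLike.congr_fun h.mfderiv v

end Coordinates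

/-! ### The connection form and the projection to the twistor bundle -/

section Connection

set_option synthInstance.maxHeartbeats 200000

theorem ext_stdVec {n : ℕ} {V : Type*} [AddCommGroup V] [Module ℝ V] [TopologicalSpace V]
    {f g : R2n n →L[ℝ] V} (h : ∀ A, f (stdVec n A) = g (stdVec n A)) : f = g := by
  refine ContinuousLinearMap.coe_injective
    ((EuclideanSpace.basisFun (Fin n ⊕ Fin n) ℝ).toBasis.ext fun A ↦ ?_)
  simpa [stdVec] using h A

variable {n : ℕ} {M : Type*} [TopologicalSpace M] [ChartedSpace (Model n) M]
  [IsManifold (𝓡 (2 * n)) ∞ M]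

/-- A smooth coordinate expression near `x` defines a frame field which is smooth near `x`. -/
theorem exists_frameField {x : M} {σ : M → R2n n →L[ℝ] Model n}
    (hσ : ContMDiffAt (𝓡 (2 * n)) 𝓘(ℝ, R2n n →L[ℝ] Model n) ∞ σ x) :
    ∃ s : ∀ y : M, Bundle.Trivial M (R2n n) y →L[ℝ] TangentSpace (𝓡 (2 * n)) y,
      s x = σ x ∧
      ContMDiffAt (𝓡 (2 * n)) (frameModel n) ∞ (fun y ↦ (⟨y, s y⟩ : FrameSpace n M)) x ∧
      ∀ᶠ y in 𝓝 x, frameCoord x (⟨y, s y⟩ : FrameSpace n M) = σ y := by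
  let t := trivializationAt (R2n n →L[ℝ] Model n)
    (fun x : M ↦ Bundle.Trivial M (R2n n) x →L[ℝ] TangentSpace (𝓡 (2 * n)) x) x
  have hx : x ∈ t.baseSet := mem_baseSet_trivializationAt _ _ x
  have hc : ∀ y ∈ t.baseSet,
      frameCoord x (⟨y, t.symm y (σ y)⟩ : FrameSpace n M) = σ y := fun y hy ↦
    congrArg Prod.snd (t.apply_mk_symm hy (σ y))
  have hev : ∀ᶠ y in 𝓝 x, frameCoord x (⟨y, t.symm y (σ y)⟩ : FrameSpace n M) = σ y :=
    Filter.mem_of_superset (t.open_baseSet.mem_nhds hx) hc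
  refine ⟨fun y ↦ t.symm y (σ y), ?_, ?_, hev⟩
  · exact (frameCoord_self (⟨x, t.symm x (σ x)⟩ : FrameSpace n M)).symm.trans (hc x hx)
  · exact (contMDiffAt_section _).2 (hσ.congr_of_eventuallyEq hev)

variable [RiemannianBundle (fun x : M ↦ TangentSpace (𝓡 (2 * n)) x)]

/-- The canonical form is the base component, in terms of the frame. -/
theorem Theta_frameTangent {e : FrameSpace n M}
    (he : ∀ u w, inner ℝ (e.snd u) (e.snd w) = (inner ℝ u w : ℝ)) (w : R2n n)
    (a : R2n n →L[ℝ] TangentSpace (𝓡 (2 * n)) e.proj) :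
    Theta e (frameTangent e (e.snd w) a) = w := by
  ext A
  have h : mfderiv (frameModel n) (𝓡 (2 * n)) (fun f : FrameSpace n M ↦ f.proj) e
      (frameTangent e (e.snd w) a) = e.snd w :=
    DFunLike.congr_fun (hasMFDerivAt_frame_proj e).mfderiv (frameTangent e (e.snd w) a)
  simp only [Theta, h, frameVec]
  rw [he]
  simp [stdVec, EuclideanSpace.inner_single_right]

variable [IsContMDiffRiemannianBundle (𝓡 (2 * n)) ∞ (Model n)
  (fun x : M ↦ TangentSpace (𝓡 (2 * n)) x)]

/-- The differentiated orthonormality relations, in coordinates. -/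
theorem frameTangent_mem_tangentFrame {e : FrameSpace n M} {v : TangentSpace (𝓡 (2 * n)) e.proj}
    {a : R2n n →L[ℝ] TangentSpace (𝓡 (2 * n)) e.proj} :
    frameTangent e v a ∈ tangentFrame e ↔ ∀ A B : Fin n ⊕ Fin n,
      inner ℝ (a (stdVec n A) + christoffel e.proj v (frameVec e A)) (frameVec e B) +
        inner ℝ (frameVec e A) (a (stdVec n B) + christoffel e.proj v (frameVec e B)) = 0 := by
  have key : ∀ A B : Fin n ⊕ Fin n, mvfderiv (frameModel n)
      (fun f : FrameSpace n M ↦ inner ℝ (frameVec f A) (frameVec f B)) e (frameTangent e v a) =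
      inner ℝ (a (stdVec n A) + christoffel e.proj v (frameVec e A)) (frameVec e B) +
        inner ℝ (frameVec e A) (a (stdVec n B) + christoffel e.proj v (frameVec e B)) := by
    intro A B
    have hd : ∀ A : Fin n ⊕ Fin n, HasMFDerivAt (frameModel n) 𝓘(ℝ, Model n)
        (fun f : FrameSpace n M ↦ frameCoord e.proj f (stdVec n A)) e _ := fun A ↦
      (ContinuousLinearMap.apply ℝ (Model n) (stdVec n A)).comp_hasMFDerivAt
        (hasMFDerivAt_frameCoord e)
    have hn : ∀ A : Fin n ⊕ Fin n, ∀ᶠ f in 𝓝 e,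
        coord e.proj (frameVec f A) = frameCoord e.proj f (stdVec n A) := fun A ↦
      Filter.mem_of_superset ((hasMFDerivAt_frame_proj e).1 (coordDomain_mem_nhds (n := n) e.proj))
        fun f hf ↦ (frameCoord_apply hf _).symm
    have h0 : ∀ A : Fin n ⊕ Fin n, frameCoord e.proj e (stdVec n A) = frameVec e A := fun A ↦ by
      rw [frameCoord_self]; rfl
    exact mvfderiv_inner rfl (hasMFDerivAt_frame_proj e) (hd A) (hd B) (hn A) (hn B) (h0 A) (h0 B)
      (frameTangent e v a)
  simp only [tangentFrame, Submodule.mem_iInf]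
  exact forall₂_congr fun A B ↦ by rw [← key A B]; rfl

/-- The Christoffel symbol `Γ(v, ·)` as a continuous endomorphism of the tangent space. -/
def christoffelL (x : M) (v : TangentSpace (𝓡 (2 * n)) x) :
    TangentSpace (𝓡 (2 * n)) x →L[ℝ] TangentSpace (𝓡 (2 * n)) x :=
  LinearMap.toContinuousLinearMap (christoffel x v)

/-- The map `v ↦ Γ(v, ·) ∘ L`. -/
def christoffelComp (x : M) (L : R2n n →L[ℝ] TangentSpace (𝓡 (2 * n)) x) :
    TangentSpace (𝓡 (2 * n)) x →ₗ[ℝ] R2n n →L[ℝ] TangentSpace (𝓡 (2 * n)) x where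
  toFun v := christoffelL x v ∘L L
  map_add' v w := ContinuousLinearMap.ext fun u ↦ by
    change christoffel x (v + w) (L u) = christoffel x v (L u) + christoffel x w (L u)
    rw [map_add, LinearMap.add_apply]
  map_smul' r v := ContinuousLinearMap.ext fun u ↦ by
    change christoffel x (r • v) (L u) = r • christoffel x v (L u)
    rw [map_smul, LinearMap.smul_apply]

/-- The horizontal space of the Levi-Civita connection, in coordinates. -/
theorem mem_horizontal_iff {e : FrameSpace n M} {Z : TangentSpace (frameModel n) e} :
    Z ∈ horizontal e ↔
      ∃ v, Z = frameTangent e v (-(christoffelL e.proj v ∘L e.snd)) := by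
  obtain ⟨x, L⟩ := e
  constructor
  · rintro ⟨s, v, hsx, hs, hn, rfl⟩
    change s x = L at hsx
    subst hsx
    have hd :=
      ((mdifferentiableAt_totalSpace _ _).1 (hs.mdifferentiableAt (by simp))).2.hasMFDerivAt
    refine ⟨v, ?_⟩
    rw [mfderiv_frameField hd]
    refine congrArg (frameTangent ⟨x, s x⟩ v) (ext_stdVec fun A ↦ ?_)
    have h := leviCivita_eq (Y := fun y ↦ frameVec (⟨y, s y⟩ : FrameSpace n M) A)
      ((ContinuousLinearMap.apply ℝ (Model n) (stdVec n A)).comp_hasMFDerivAt hd)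
      (Filter.mem_of_superset (coordDomain_mem_nhds (n := n) x) fun y hy ↦
        (frameCoord_apply (f := (⟨y, s y⟩ : FrameSpace n M)) hy (stdVec n A)).symm) v
    exact eq_neg_of_add_eq_zero_left (h.symm.trans (hn A))
  · rintro ⟨v, rfl⟩
    -- an affine frame field in the coordinates at `x`, with derivative `-Γ(·, L)`
    obtain ⟨σ, hσx, hσ, hσ'⟩ := exists_contMDiffAt_hasMFDerivAt (F := R2n n →L[ℝ] Model n)
      (I := 𝓡 (2 * n)) (x := x) L (LinearMap.toContinuousLinearMap (-christoffelComp x L))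
    obtain ⟨s, hsx, hs, hsσ⟩ := exists_frameField hσ
    have hsx' : s x = L := hsx.trans hσx
    have hd := hσ'.congr_of_eventuallyEq hsσ
    refine ⟨s, v, hsx', hs, fun A ↦ ?_, ?_⟩
    · refine (leviCivita_eq (Y := fun y ↦ frameVec (⟨y, s y⟩ : FrameSpace n M) A)
        ((ContinuousLinearMap.apply ℝ (Model n) (stdVec n A)).comp_hasMFDerivAt hd)
        (Filter.mem_of_superset (coordDomain_mem_nhds (n := n) x) fun y hy ↦
          (frameCoord_apply (f := (⟨y, s y⟩ : FrameSpace n M)) hy (stdVec n A)).symm) v).trans ?_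
      subst hsx'
      exact neg_add_cancel (christoffel x v (s x (stdVec n A)))
    · subst hsx'
      exact mfderiv_frameField hd v

/-- The Levi-Civita connection form in coordinates: `Ω(v, a) = e⁻¹ (a + Γ_v e)`. -/
theorem Omega_frameTangent {e : FrameSpace n M} (he : Function.Injective e.snd)
    {v : TangentSpace (𝓡 (2 * n)) e.proj} {a : R2n n →L[ℝ] TangentSpace (𝓡 (2 * n)) e.proj}
    {m : End2n n} (hm : IsSkew m) (h : ∀ u, e.snd (m u) = a u + christoffel e.proj v (e.snd u)) :
    Omega e (frameTangent e v a) = m := by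
  have hex : ∃ l : End2n n, IsSkew l ∧ frameTangent e v a - fundamental e l ∈ horizontal e := by
    refine ⟨m, hm, mem_horizontal_iff.2 ⟨v, ?_⟩⟩
    rw [fundamental_eq, frameTangent_sub, sub_zero]
    refine congrArg (frameTangent e v) (ContinuousLinearMap.ext fun u ↦ ?_)
    change a u - e.snd (m u) = -christoffel e.proj v (e.snd u)
    rw [h u, sub_add_cancel_left]
  obtain ⟨-, h2⟩ := Classical.epsilon_spec hex
  obtain ⟨w, hw⟩ := mem_horizontal_iff.1 h2
  rw [fundamental_eq, frameTangent_sub, sub_zero] at hw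
  obtain ⟨rfl, hw2⟩ := frameTangent_inj hw
  refine ContinuousLinearMap.ext fun u ↦ he ?_
  rw [h u]
  have h3 : a u - e.snd (Omega e (frameTangent e v a) u) = -christoffel e.proj v (e.snd u) :=
    DFunLike.congr_fun hw2 u
  rw [sub_eq_iff_eq_add] at h3
  rw [h3, neg_add_cancel_comm]

end Connection

section Xi

set_option synthInstance.maxHeartbeats 200000

variable {n : ℕ} {M : Type*} [TopologicalSpace M] [ChartedSpace (Model n) M]
  [IsManifold (𝓡 (2 * n)) ∞ M]

theorem frameCoord_eq_comp {x : M} {f : FrameSpace n M} (hf : f.proj ∈ coordDomain n x) :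
    frameCoord x f = (coordEquiv hf).toContinuousLinearMap ∘L
      (f.snd : R2n n →L[ℝ] TangentSpace (𝓡 (2 * n)) f.proj) :=
  ContinuousLinearMap.ext fun u ↦ frameCoord_apply hf u

/-- The formula `ξ(e) = e J₀ e⁻¹` in coordinates. -/
theorem endCoord_xi {x : M} {f : FrameSpace n M} (hf : f.proj ∈ coordDomain n x) :
    endCoord x (xi f) = (frameCoord x f ∘L J₀ n) ∘L (frameCoord x f).inverse := by
  have hi : (frameCoord x f).inverse =
      (f.snd : R2n n →L[ℝ] TangentSpace (𝓡 (2 * n)) f.proj).inverse ∘L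
        (coordEquiv hf).symm.toContinuousLinearMap := by
    rw [frameCoord_eq_comp hf]
    exact ContinuousLinearMap.inverse_equiv_comp
  ext1 z
  have h := endCoord_apply (j := xi f) hf ((coordEquiv hf).symm z)
  have hz : coord x ((coordEquiv hf).symm z) = z := (coordEquiv hf).apply_symm_apply z
  rw [hi]
  exact (congrArg (endCoord x (xi f)) hz).symm.trans (h.trans (frameCoord_apply hf _).symm)

/-- `ξ` is differentiable at invertible frames, and its derivative is found by differentiating
`e J₀ = ξ(e) e`. -/
theorem exists_hasMFDerivAt_xi {e : FrameSpace n M} (he : (frameCoord e.proj e).IsInvertible) :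
    ∃ D : (Model n × (R2n n →L[ℝ] Model n)) →L[ℝ] Model n →L[ℝ] Model n,
      HasMFDerivAt (frameModel n) 𝓘(ℝ, Model n →L[ℝ] Model n)
        (fun f : FrameSpace n M ↦ endCoord e.proj (xi f)) e D ∧
      ∀ X u, X.2 (J₀ n u) =
        endCoord e.proj (xi e) (X.2 u) + D X (frameCoord e.proj e u) := by
  have hdom : ∀ᶠ f in 𝓝 e, f.proj ∈ coordDomain n e.proj :=
    (hasMFDerivAt_frame_proj e).1 (coordDomain_mem_nhds (n := n) e.proj)
  have hfc := hasMFDerivAt_frameCoord e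
  obtain ⟨L, hL⟩ := he
  have hg : DifferentiableAt ℝ (fun A : R2n n →L[ℝ] Model n ↦ (A ∘L J₀ n) ∘L A.inverse)
      (frameCoord e.proj e) := by
    have h1 : DifferentiableAt ℝ (fun A : R2n n →L[ℝ] Model n ↦ A.inverse)
        (frameCoord e.proj e) := by
      rw [← hL]
      exact (contDiffAt_map_inverse (n := 1) L).differentiableAt (by simp)
    exact (differentiableAt_id.clm_comp (differentiableAt_const _)).clm_comp h1
  have hD := (hg.hasFDerivAt.comp_hasMFDerivAt hfc).congr_of_eventuallyEq
    (hdom.mono fun f hf ↦ endCoord_xi hf)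
  refine ⟨_, hD, fun X u ↦ ?_⟩
  have hinv : ∀ᶠ f in 𝓝 e, (frameCoord e.proj f).IsInvertible := by
    have := hfc.1 (by rw [← hL]; exact ContinuousLinearEquiv.nhds L)
    filter_upwards [this] with f hf using hf
  have hcomp : (fun f ↦ frameCoord e.proj f (J₀ n u)) =ᶠ[𝓝 e]
      fun f ↦ endCoord e.proj (xi f) (frameCoord e.proj f u) := by
    filter_upwards [hdom, hinv] with f h1 h2
    rw [endCoord_xi h1]
    exact congrArg (fun w ↦ frameCoord e.proj f (J₀ n w)) (h2.inverse_apply_self u).symm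
  have d1 := (ContinuousLinearMap.apply ℝ (Model n) (J₀ n u)).comp_hasMFDerivAt hfc
  have d2 := (ContinuousLinearMap.id ℝ (Model n →L[ℝ] Model n)).hasMFDerivAt_of_bilinear hD
    ((ContinuousLinearMap.apply ℝ (Model n) u).comp_hasMFDerivAt hfc)
  exact DFunLike.congr_fun (hasMFDerivAt_unique d1 (d2.congr_of_eventuallyEq hcomp)) X

/-- The differential of `ξ` in coordinates: since `ξ(e) e = e J₀`, its fibre component `b` satisfies
`b e = a J₀ - J a`, where `J = ξ(e)`. -/
theorem xiStar_frameTangent {e : FrameSpace n M}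
    (he : (e.snd : R2n n →L[ℝ] TangentSpace (𝓡 (2 * n)) e.proj).IsInvertible)
    {J : TangentSpace (𝓡 (2 * n)) e.proj →L[ℝ] TangentSpace (𝓡 (2 * n)) e.proj}
    (hJ : (xi e).snd = J)
    (v : TangentSpace (𝓡 (2 * n)) e.proj) (a : R2n n →L[ℝ] TangentSpace (𝓡 (2 * n)) e.proj) :
    ∃ b : TangentSpace (𝓡 (2 * n)) e.proj →L[ℝ] TangentSpace (𝓡 (2 * n)) e.proj,
      xiStar e (frameTangent e v a) = endTangent (xi e) v b ∧
      ∀ u, b (e.snd u) = a (J₀ n u) - J (a u) := by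
  have hL : frameCoord e.proj e = e.snd := frameCoord_self e
  obtain ⟨D, hD, hDe⟩ := exists_hasMFDerivAt_xi (e := e) (by rw [hL]; exact he)
  have hxi := HasMFDerivAt.totalSpace (IB := 𝓡 (2 * n)) (f := xi (n := n) (M := M)) (p := e)
    (hasMFDerivAt_frame_proj e) hD
  refine ⟨D (v, a), DFunLike.congr_fun hxi.mfderiv (frameTangent e v a), fun u ↦ ?_⟩
  have hJ' : endCoord e.proj (xi e) = J := (endCoord_self (xi e)).trans hJ
  have h := hDe (v, a) u
  rw [hL, hJ'] at h
  exact eq_sub_of_add_eq' h.symm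

end Xi

/-! ### The covariant derivative of the almost complex structure -/

section Nabla

set_option synthInstance.maxHeartbeats 200000

variable {n : ℕ} {M : Type*} [TopologicalSpace M] [ChartedSpace (Model n) M]
  [IsManifold (𝓡 (2 * n)) ∞ M]

/-- The derivative at `x` of a field of endomorphisms in the trivialization at `x`. -/
def endDeriv (J : ∀ x : M, TangentSpace (𝓡 (2 * n)) x →L[ℝ] TangentSpace (𝓡 (2 * n)) x) (x : M) :
    TangentSpace (𝓡 (2 * n)) x →L[ℝ] Model n →L[ℝ] Model n :=
  mfderiv (𝓡 (2 * n)) 𝓘(ℝ, Model n →L[ℝ] Model n) (fun y ↦ endCoord x (endSection J y)) x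

/-- The coordinate derivative of a field of endomorphisms as a bilinear map on the tangent space. -/
def endDerivMap (J : ∀ x : M, TangentSpace (𝓡 (2 * n)) x →L[ℝ] TangentSpace (𝓡 (2 * n)) x)
    (x : M) : TangentSpace (𝓡 (2 * n)) x →ₗ[ℝ] TangentSpace (𝓡 (2 * n)) x →ₗ[ℝ]
      TangentSpace (𝓡 (2 * n)) x :=
  (ContinuousLinearMap.coeLM ℝ : (Model n →L[ℝ] Model n) →ₗ[ℝ] Model n →ₗ[ℝ] Model n) ∘ₗ
    (endDeriv J x).toLinearMap

variable {J : ∀ x : M, TangentSpace (𝓡 (2 * n)) x →L[ℝ] TangentSpace (𝓡 (2 * n)) x}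

theorem endCoord_endSection_self (x : M) : endCoord x (endSection J x) = J x :=
  endCoord_self (endSection J x)

theorem eventually_coord_apply_extend (J : ∀ x : M, TangentSpace (𝓡 (2 * n)) x →L[ℝ]
    TangentSpace (𝓡 (2 * n)) x) {x : M} (w : TangentSpace (𝓡 (2 * n)) x) :
    ∀ᶠ y in 𝓝 x, coord x (J y (FiberBundle.extend (Model n) w y)) =
      endCoord x (endSection J y) w := by
  filter_upwards [coordDomain_mem_nhds (n := n) x] with y hy
  have h := endCoord_apply (j := endSection J y) hy (FiberBundle.extend (Model n) w y)
  exact ((congrArg (endCoord x (endSection J y)) (coord_extend hy w)).symm.trans h).symm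

variable [RiemannianBundle (fun x : M ↦ TangentSpace (𝓡 (2 * n)) x)]

theorem IsAlmostHermitian.hasMFDerivAt (hJ : IsAlmostHermitian J) (x : M) :
    HasMFDerivAt (𝓡 (2 * n)) 𝓘(ℝ, Model n →L[ℝ] Model n) (fun y ↦ endCoord x (endSection J y)) x
      (endDeriv J x) :=
  ((mdifferentiableAt_totalSpace _ _).1
    ((hJ.smooth x).mdifferentiableAt (by simp))).2.hasMFDerivAt

/-- The coordinate expression of `J` applied to a constant vector field. -/
theorem IsAlmostHermitian.hasMFDerivAt_apply (hJ : IsAlmostHermitian J) (x : M)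
    (w : TangentSpace (𝓡 (2 * n)) x) :
    HasMFDerivAt (𝓡 (2 * n)) 𝓘(ℝ, Model n) (fun y ↦ endCoord x (endSection J y) w) x
      ((endDerivMap J x).flip w).toContinuousLinearMap :=
  (ContinuousLinearMap.apply ℝ (Model n) (w : Model n)).comp_hasMFDerivAt (hJ.hasMFDerivAt x)

/-- The derivative of `J² = -1`, in coordinates. -/
theorem endDerivMap_anti (hJ : IsAlmostHermitian J) (x : M) (v w : TangentSpace (𝓡 (2 * n)) x) :
    endDerivMap J x v (J x w) + J x (endDerivMap J x v w) = 0 := by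
  have d := (ContinuousLinearMap.id ℝ (Model n →L[ℝ] Model n)).hasMFDerivAt_of_bilinear
    (hJ.hasMFDerivAt x) (hJ.hasMFDerivAt_apply x w)
  have hev : (fun _ : M ↦ -(w : Model n)) =ᶠ[𝓝 x]
      fun y ↦ endCoord x (endSection J y) (endCoord x (endSection J y) w) := by
    filter_upwards [coordDomain_mem_nhds (n := n) x, eventually_coord_apply_extend J w]
      with y hy h
    have h1 := endCoord_apply (j := endSection J y) hy (J y (FiberBundle.extend (Model n) w y))
    have h2 := hJ.sq y (FiberBundle.extend (Model n) w y)
    have h3 : coord x (-(FiberBundle.extend (Model n) w y)) = -(w : Model n) := by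
      rw [← coordEquiv_apply hy, map_neg, coordEquiv_apply hy, coord_extend hy]; rfl
    exact h3.symm.trans ((congrArg (coord x) h2.symm).trans
      (h1.symm.trans (congrArg (endCoord x (endSection J y)) h)))
  have h := DFunLike.congr_fun (hasMFDerivAt_unique (d.congr_of_eventuallyEq hev)
    (hasMFDerivAt_const_model x (-(w : Model n)))) v
  have h' : J x (endDerivMap J x v w) + endDerivMap J x v (J x w) = 0 := by
    have hs : ∀ u : TangentSpace (𝓡 (2 * n)) x, endCoord x (endSection J x) u = J x u := fun u ↦
      DFunLike.congr_fun (endCoord_endSection_self x) u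
    rw [← hs, ← hs w]
    exact h
  rw [add_comm]
  exact h'

variable [IsContMDiffRiemannianBundle (𝓡 (2 * n)) ∞ (Model n)
  (fun x : M ↦ TangentSpace (𝓡 (2 * n)) x)]

/-- The covariant derivative `(∇_v J) w` of a field of endomorphisms at `x`. -/
def nabla (J : ∀ x : M, TangentSpace (𝓡 (2 * n)) x →L[ℝ] TangentSpace (𝓡 (2 * n)) x) (x : M) :
    TangentSpace (𝓡 (2 * n)) x →ₗ[ℝ] TangentSpace (𝓡 (2 * n)) x →ₗ[ℝ]
      TangentSpace (𝓡 (2 * n)) x :=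
  endDerivMap J x + (christoffel x).compl₂ (J x).toLinearMap
    - (christoffel x).compr₂ (J x).toLinearMap

theorem nabla_apply (x : M) (v w : TangentSpace (𝓡 (2 * n)) x) :
    nabla J x v w = endDerivMap J x v w + christoffel x v (J x w) - J x (christoffel x v w) := rfl

theorem nabla_anti (hJ : IsAlmostHermitian J) (x : M) (v w : TangentSpace (𝓡 (2 * n)) x) :
    nabla J x v (J x w) = -J x (nabla J x v w) := by
  rw [nabla_apply, nabla_apply, map_sub, map_add, hJ.sq, hJ.sq, map_neg,
    eq_neg_of_add_eq_zero_left (endDerivMap_anti hJ x v w)]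
  abel

/-- `∇_v J` is skew. This comes from differentiating `⟨JX, JY⟩ = ⟨X, Y⟩` for fields `X`, `Y` that are
constant in the coordinates at `x`, the connection being metric. -/
theorem nabla_skew (hJ : IsAlmostHermitian J) (x : M) (v u w : TangentSpace (𝓡 (2 * n)) x) :
    inner ℝ (nabla J x v u) w = -inner ℝ u (nabla J x v w) := by
  have hid := hasMFDerivAt_id (I := 𝓡 (2 * n)) x
  have key : ∀ u w : TangentSpace (𝓡 (2 * n)) x,
      inner ℝ (nabla J x v u) (J x w) + inner ℝ (J x u) (nabla J x v w) = 0 := by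
    intro u w
    have hs : ∀ u : TangentSpace (𝓡 (2 * n)) x, endCoord x (endSection J x) u = J x u := fun u ↦
      DFunLike.congr_fun (endCoord_endSection_self x) u
    have e1 := mvfderiv_inner (x := x) rfl hid (hJ.hasMFDerivAt_apply x u)
      (hJ.hasMFDerivAt_apply x w) (eventually_coord_apply_extend J u)
      (eventually_coord_apply_extend J w) (hs u) (hs w) v
    have e2 := mvfderiv_inner (x := x) rfl hid (hasMFDerivAt_const_model x u)
      (hasMFDerivAt_const_model x w) (eventually_coord_extend u) (eventually_coord_extend w)
      rfl rfl v
    have hfun : (fun y ↦ inner ℝ (J y (FiberBundle.extend (Model n) u y))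
        (J y (FiberBundle.extend (Model n) w y))) =
        fun y ↦ (inner ℝ (FiberBundle.extend (Model n) u y)
          (FiberBundle.extend (Model n) w y) : ℝ) :=
      funext fun y ↦ hJ.orth y _ _
    have e3 : inner ℝ (endDerivMap J x v u + christoffel x v (J x u)) (J x w) +
        inner ℝ (J x u) (endDerivMap J x v w + christoffel x v (J x w)) =
        inner ℝ (0 + christoffel x v u) w + inner ℝ u (0 + christoffel x v w) :=
      e1.symm.trans ((congrArg (fun f ↦ mvfderiv (𝓡 (2 * n)) f x v) hfun).trans e2)
    rw [zero_add, zero_add] at e3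
    rw [nabla_apply, nabla_apply, inner_sub_left, inner_sub_right, hJ.orth, hJ.orth]
    linarith
  have h := key u (J x w)
  rw [nabla_anti hJ, hJ.sq, inner_neg_right, inner_neg_right, hJ.orth] at h
  linarith

/-- The Nijenhuis tensor in terms of `∇J`. The Christoffel symbols cancel because the Levi-Civita
connection is torsion free. -/
theorem nijenhuis_eq (hJ : IsAlmostHermitian J) (x : M) (v w : TangentSpace (𝓡 (2 * n)) x) :
    nijenhuis J x v w = nabla J x (J x v) w - nabla J x (J x w) v
      + J x (nabla J x w v) - J x (nabla J x v w) := by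
  have hv := hasMFDerivAt_const_model x v
  have hw := hasMFDerivAt_const_model x w
  have hJv := hJ.hasMFDerivAt_apply x v
  have hJw := hJ.hasMFDerivAt_apply x w
  have cv := eventually_coord_extend v
  have cw := eventually_coord_extend w
  have cJv := eventually_coord_apply_extend J v
  have cJw := eventually_coord_apply_extend J w
  have hs : ∀ u : TangentSpace (𝓡 (2 * n)) x, endCoord x (endSection J x) u = J x u := fun u ↦
    DFunLike.congr_fun (endCoord_endSection_self x) u
  have b1 : VectorField.mlieBracket (𝓡 (2 * n))
      (fun y ↦ J y (FiberBundle.extend (Model n) v y))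
      (fun y ↦ J y (FiberBundle.extend (Model n) w y)) x =
      endDerivMap J x (J x v) w - endDerivMap J x (J x w) v := by
    rw [← hs v, ← hs w]
    exact mlieBracket_eq_of_coord hJv hJw cJv cJw
  have b2 : VectorField.mlieBracket (𝓡 (2 * n)) (FiberBundle.extend (Model n) v)
      (FiberBundle.extend (Model n) w) x = 0 :=
    (mlieBracket_eq_of_coord hv hw cv cw).trans (sub_zero (0 : TangentSpace (𝓡 (2 * n)) x))
  have b3 : VectorField.mlieBracket (𝓡 (2 * n))
      (fun y ↦ J y (FiberBundle.extend (Model n) v y)) (FiberBundle.extend (Model n) w) x =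
      -endDerivMap J x w v :=
    (mlieBracket_eq_of_coord hJv hw cJv cw).trans (zero_sub (endDerivMap J x w v))
  have b4 : VectorField.mlieBracket (𝓡 (2 * n)) (FiberBundle.extend (Model n) v)
      (fun y ↦ J y (FiberBundle.extend (Model n) w y)) x = endDerivMap J x v w :=
    (mlieBracket_eq_of_coord hv hJw cv cJw).trans (sub_zero (endDerivMap J x v w))
  rw [nijenhuis, nijenhuisField, b1, b2, b3, b4]
  simp only [nabla_apply, map_sub, map_add, map_neg, hJ.sq]
  rw [christoffel_symm x (J x v) (J x w), christoffel_symm x (J x v) w,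
    christoffel_symm x (J x w) v, christoffel_symm x w v]
  abel

end Nabla

/-! ### Linear algebra of an almost Hermitian vector space -/

section LinearAlgebra

variable {V : Type*} [NormedAddCommGroup V] [InnerProductSpace ℝ V]
  {ι κ : Type*} [Fintype ι] [Fintype κ]

/-- A bilinear map with values in skew endomorphisms is determined by its antisymmetrization, in the
same way as a metric connection is determined by its torsion. -/
theorem two_mul_inner_of_skew {D : V →ₗ[ℝ] V →ₗ[ℝ] V}
    (hD : ∀ X Y Z, inner ℝ (D X Y) Z = -(inner ℝ Y (D X Z) : ℝ)) (X Y Z : V) :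
    2 * inner ℝ (D X Y) Z = (inner ℝ ((D - D.flip) X Y) Z - inner ℝ ((D - D.flip) Y Z) X
      + inner ℝ ((D - D.flip) Z X) Y : ℝ) := by
  simp only [LinearMap.sub_apply, LinearMap.flip_apply, inner_sub_left]
  rw [hD Y X Z, hD Z Y X, hD X Z Y, real_inner_comm (D Y Z) X, real_inner_comm (D Z X) Y,
    real_inner_comm (D X Y) Z]
  ring

theorem inner_apply_self_of_orth {J : V →ₗ[ℝ] V} (hJ : ∀ X, J (J X) = -X)
    (hJo : ∀ X Y, inner ℝ (J X) (J Y) = (inner ℝ X Y : ℝ)) (X : V) : inner ℝ (J X) X = (0 : ℝ) := by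
  have h := hJo X (J X)
  rw [hJ, inner_neg_right, real_inner_comm] at h
  rw [real_inner_comm]
  linarith

theorem norm_apply_of_orth {J : V →ₗ[ℝ] V}
    (hJo : ∀ X Y, inner ℝ (J X) (J Y) = (inner ℝ X Y : ℝ)) (X : V) : ‖J X‖ = ‖X‖ := by
  rw [← sq_eq_sq₀ (norm_nonneg _) (norm_nonneg _), ← real_inner_self_eq_norm_sq,
    ← real_inner_self_eq_norm_sq, hJo]

/-- If a nonnegative symmetric array vanishes on the pairs of elements of `{p, q}`, its rows and
columns of indices `p` and `q` have disjoint supports. -/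
theorem two_mul_sum_rows_le [DecidableEq ι] {f : ι → ι → ℝ} (hf : ∀ A B, 0 ≤ f A B)
    (hs : ∀ A B, f A B = f B A) {p q : ι} (hne : p ≠ q) (hpp : f p p = 0) (hqq : f q q = 0)
    (hpq : f p q = 0) :
    2 * (∑ B, f p B + ∑ B, f q B) ≤ ∑ A, ∑ B, f A B := by
  have hqp : f q p = 0 := (hs q p).trans hpq
  have h : ∀ A B, (if A = p then f p B else 0) + (if A = q then f q B else 0)
      + ((if B = p then f A p else 0) + (if B = q then f A q else 0)) ≤ f A B := by
    intro A B
    by_cases h1 : A = p <;> by_cases h2 : A = q <;> by_cases h3 : B = p <;> by_cases h4 : B = q <;>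
      simp_all
  have h' := Finset.sum_le_sum fun A (_ : A ∈ Finset.univ) ↦
    Finset.sum_le_sum fun B (_ : B ∈ Finset.univ) ↦ h A B
  simp only [Finset.sum_add_distrib, Finset.sum_ite_eq', Finset.mem_univ, if_true] at h'
  rw [Finset.sum_comm (f := fun A B ↦ if A = p then f p B else 0),
    Finset.sum_comm (f := fun A B ↦ if A = q then f q B else 0)] at h'
  simp only [Finset.sum_ite_eq', Finset.mem_univ, if_true] at h'
  rw [Finset.sum_congr rfl fun A _ ↦ hs A p, Finset.sum_congr rfl fun A _ ↦ hs A q] at h'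
  linarith

/-- The form `⟨JX, Y⟩ - ¼ tr (J Q_X Q_Y)` on an almost Hermitian vector space, for skew `Q_X`
anticommuting with `J`; the trace is written as a sum over an orthonormal basis. -/
def twistorForm (J : V →ₗ[ℝ] V) (Q : V →ₗ[ℝ] V →ₗ[ℝ] V) (b : OrthonormalBasis ι ℝ V) :
    LinearMap.BilinForm ℝ V :=
  (innerₗ V) ∘ₗ J + (1 / 4 : ℝ) • ∑ A, (innerₗ V).compl₁₂ (J ∘ₗ Q.flip (b A)) (Q.flip (b A))

theorem twistorForm_apply (J : V →ₗ[ℝ] V) (Q : V →ₗ[ℝ] V →ₗ[ℝ] V) (b : OrthonormalBasis ι ℝ V)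
    (X Y : V) : twistorForm J Q b X Y =
      inner ℝ (J X) Y + 1 / 4 * ∑ A, inner ℝ (J (Q X (b A))) (Q Y (b A)) := by
  simp [twistorForm, LinearMap.sum_apply]

theorem twistorForm_isAlt {J : V →ₗ[ℝ] V} (hJ : ∀ X, J (J X) = -X)
    (hJo : ∀ X Y, inner ℝ (J X) (J Y) = (inner ℝ X Y : ℝ)) (Q : V →ₗ[ℝ] V →ₗ[ℝ] V)
    (b : OrthonormalBasis ι ℝ V) : (twistorForm J Q b).IsAlt := fun X ↦ by
  simp [twistorForm_apply, inner_apply_self_of_orth hJ hJo]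

theorem nondegenerate_of_isAlt_of_pos {φ : LinearMap.BilinForm ℝ V} (hφ : φ.IsAlt) (J : V → V)
    (h : ∀ X, X ≠ 0 → 0 < φ X (J X)) : φ.Nondegenerate := by
  constructor
  · intro X hX
    by_contra h0
    exact (h X h0).ne' (hX (J X))
  · intro X hX
    by_contra h0
    refine (h X h0).ne' ?_
    rw [← hφ.neg_eq, hX, neg_zero]

variable [FiniteDimensional ℝ V]

theorem sum_inner_apply_eq_trace {W : Type*} [NormedAddCommGroup W] [InnerProductSpace ℝ W]
    [FiniteDimensional ℝ W] (S T : V →ₗ[ℝ] W) (b : OrthonormalBasis ι ℝ V) :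
    ∑ A, inner ℝ (S (b A)) (T (b A)) = LinearMap.trace ℝ V (S.adjoint ∘ₗ T) := by
  classical
  rw [LinearMap.trace_eq_sum_inner _ b]
  exact Finset.sum_congr rfl fun A _ ↦ by
    rw [LinearMap.comp_apply, LinearMap.adjoint_inner_right]

/-- The sum `∑_A ⟨S e_A, T e_A⟩` does not depend on the orthonormal basis. -/
theorem sum_inner_apply_eq (S T : V →ₗ[ℝ] V) (b : OrthonormalBasis ι ℝ V)
    (b' : OrthonormalBasis κ ℝ V) :
    ∑ A, inner ℝ (S (b A)) (T (b A)) = (∑ A, inner ℝ (S (b' A)) (T (b' A)) : ℝ) := by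
  rw [sum_inner_apply_eq_trace, sum_inner_apply_eq_trace]

theorem sum_sum_norm_sq_apply_eq (N : V →ₗ[ℝ] V →ₗ[ℝ] V) (b : OrthonormalBasis ι ℝ V)
    (b' : OrthonormalBasis κ ℝ V) :
    ∑ A, ∑ B, ‖N (b A) (b B)‖ ^ 2 = ∑ A, ∑ B, ‖N (b' A) (b' B)‖ ^ 2 := by
  simp only [← real_inner_self_eq_norm_sq]
  rw [Finset.sum_congr rfl fun A _ ↦ sum_inner_apply_eq (N (b A)) (N (b A)) b b',
    Finset.sum_comm]
  refine (Finset.sum_congr rfl fun B _ ↦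
    sum_inner_apply_eq (N.flip (b' B)) (N.flip (b' B)) b b').trans ?_
  exact Finset.sum_comm

/-- The estimate `|D_X|² ≤ ¾ |N|²` for a unit vector `X`, where `N(X, Y) = D_X Y - D_Y X`. In an
orthonormal basis containing `X` and `JX`, the components of `D_X` and of `D_{JX}` are combinations
of those components of `N` that have an index belonging to `X` or to `JX`; no component of `N` is
counted too often, since `N(X, JX) = 0`. -/
theorem sum_norm_sq_le_of_norm_eq_one {J : V →ₗ[ℝ] V} (hJ : ∀ X, J (J X) = -X)
    (hJo : ∀ X Y, inner ℝ (J X) (J Y) = (inner ℝ X Y : ℝ)) {D : V →ₗ[ℝ] V →ₗ[ℝ] V}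
    (hD : ∀ X Y Z, inner ℝ (D X Y) Z = -(inner ℝ Y (D X Z) : ℝ))
    (hDJ : ∀ X Y, D X (J Y) = -J (D X Y)) (hJD : ∀ X Y, D (J X) Y = -J (D X Y))
    (b : OrthonormalBasis ι ℝ V) {X : V} (hX : ‖X‖ = 1) :
    ∑ A, ‖D X (b A)‖ ^ 2 ≤ 3 / 4 * ∑ A, ∑ B, ‖(D - D.flip) (b A) (b B)‖ ^ 2 := by
  classical
  set N := D - D.flip with hN
  have hNa : ∀ Y Z, N Y Z = -N Z Y := fun Y Z ↦ by simp [hN]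
  have hXJ : inner ℝ (J X) X = (0 : ℝ) := inner_apply_self_of_orth hJ hJo X
  have hJX : ‖J X‖ = 1 := (norm_apply_of_orth hJo X).trans hX
  have hXne : X ≠ J X := by
    intro h
    rw [← h, real_inner_self_eq_norm_sq, hX] at hXJ
    norm_num at hXJ
  have horth : Orthonormal ℝ ((↑) : ({X, J X} : Set V) → V) := by
    rw [orthonormal_subtype_iff_ite]
    rintro v (rfl | rfl) w (rfl | rfl)
    · simp [hX]
    · rw [if_neg hXne, real_inner_comm, hXJ]
    · rw [if_neg hXne.symm, hXJ]
    · simp [hJX]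
  obtain ⟨u, c, hu, hc⟩ := horth.exists_orthonormalBasis_extension
  rw [sum_sum_norm_sq_apply_eq N b c]
  have hb : ∑ A, ‖D X (b A)‖ ^ 2 = ∑ A, ‖D X (c A)‖ ^ 2 := by
    simpa only [real_inner_self_eq_norm_sq] using sum_inner_apply_eq (D X) (D X) b c
  rw [hb]
  set p : u := ⟨X, hu (by simp)⟩
  set q : u := ⟨J X, hu (by simp)⟩
  have hp : c p = X := by rw [hc]
  have hq : c q = J X := by rw [hc]
  have hpq : p ≠ q := fun h ↦ hXne (congrArg Subtype.val h)
  -- Parseval, and `(x - y + z)² ≤ 3 (x² + y² + z²)`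
  have key : ∀ r, 4 * ∑ A, ‖D (c r) (c A)‖ ^ 2 ≤ 3 * (2 * ∑ A, ‖N (c r) (c A)‖ ^ 2
      + ∑ A, ∑ B, inner ℝ (N (c A) (c B)) (c r) ^ 2) := by
    intro r
    have h1 : ∀ v, ‖v‖ ^ 2 = ∑ B, inner ℝ v (c B) ^ 2 := fun v ↦ by
      rw [← c.sum_sq_norm_inner_left v]
      exact Finset.sum_congr rfl fun B _ ↦ by rw [Real.norm_eq_abs, sq_abs]
    have h2 : ∑ A, ∑ B, inner ℝ (N (c B) (c r)) (c A) ^ 2 = ∑ A, ‖N (c r) (c A)‖ ^ 2 := by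
      rw [Finset.sum_comm]
      refine Finset.sum_congr rfl fun A _ ↦ ?_
      rw [← h1, hNa, norm_neg]
    have h3 : ∑ A, ‖N (c r) (c A)‖ ^ 2 = ∑ A, ∑ B, inner ℝ (N (c r) (c A)) (c B) ^ 2 :=
      Finset.sum_congr rfl fun A _ ↦ h1 _
    have h4 : ∑ A, ‖D (c r) (c A)‖ ^ 2 = ∑ A, ∑ B, inner ℝ (D (c r) (c A)) (c B) ^ 2 :=
      Finset.sum_congr rfl fun A _ ↦ h1 _
    rw [two_mul (∑ A, ‖N (c r) (c A)‖ ^ 2)]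
    nth_rw 2 [← h2]
    rw [h3, h4, ← Finset.sum_add_distrib, ← Finset.sum_add_distrib, Finset.mul_sum, Finset.mul_sum]
    refine Finset.sum_le_sum fun A _ ↦ ?_
    rw [← Finset.sum_add_distrib, ← Finset.sum_add_distrib, Finset.mul_sum, Finset.mul_sum]
    refine Finset.sum_le_sum fun B _ ↦ ?_
    have h := two_mul_inner_of_skew hD (c r) (c A) (c B)
    rw [← hN] at h
    set x : ℝ := inner ℝ (N (c r) (c A)) (c B)
    set y : ℝ := inner ℝ (N (c A) (c B)) (c r)
    set z : ℝ := inner ℝ (N (c B) (c r)) (c A)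
    have h' := congrArg (· ^ 2) h
    simp only [mul_pow] at h'
    linarith [sq_nonneg (x + y), sq_nonneg (x - z), sq_nonneg (y + z)]
  have kp := key p
  have kq := key q
  have hDq : ∑ A, ‖D (c q) (c A)‖ ^ 2 = ∑ A, ‖D (c p) (c A)‖ ^ 2 :=
    Finset.sum_congr rfl fun A _ ↦ by
      rw [hq, hp, hJD, norm_neg, norm_apply_of_orth hJo]
  have hself : ∀ Y, N Y Y = 0 := fun Y ↦ by simp [hN]
  have hNpq : N (c p) (c q) = 0 := by
    rw [hp, hq, hN, LinearMap.sub_apply, LinearMap.sub_apply, LinearMap.flip_apply, hDJ, hJD,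
      sub_self]
  have hrow := two_mul_sum_rows_le (f := fun A B ↦ ‖N (c A) (c B)‖ ^ 2) (fun _ _ ↦ sq_nonneg _)
    (fun A B ↦ by rw [hNa, norm_neg]) hpq (by simp [hself]) (by simp [hself]) (by simp [hNpq])
  have hcol : ∑ A, ∑ B, inner ℝ (N (c A) (c B)) (c p) ^ 2 +
      ∑ A, ∑ B, inner ℝ (N (c A) (c B)) (c q) ^ 2 ≤ ∑ A, ∑ B, ‖N (c A) (c B)‖ ^ 2 := by
    rw [← Finset.sum_add_distrib]
    refine Finset.sum_le_sum fun A _ ↦ ?_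
    rw [← Finset.sum_add_distrib]
    refine Finset.sum_le_sum fun B _ ↦ ?_
    have h := Finset.sum_le_univ_sum_of_nonneg (s := {p, q})
      (fun C ↦ sq_nonneg ‖inner ℝ (N (c A) (c B)) (c C)‖)
    rw [c.sum_sq_norm_inner_left, Finset.sum_pair hpq] at h
    simpa only [Real.norm_eq_abs, sq_abs] using h
  rw [hDq] at kq
  rw [hp] at kp kq
  rw [hp] at hrow hcol
  linarith

/-- If `D_X` is skew, anticommutes with `J` and satisfies `D_{JX} = -J D_X`, the Hilbert-Schmidt norm
of `D_X` is controlled by the antisymmetrization of `D`. -/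
theorem sum_norm_sq_le {J : V →ₗ[ℝ] V} (hJ : ∀ X, J (J X) = -X)
    (hJo : ∀ X Y, inner ℝ (J X) (J Y) = (inner ℝ X Y : ℝ)) {D : V →ₗ[ℝ] V →ₗ[ℝ] V}
    (hD : ∀ X Y Z, inner ℝ (D X Y) Z = -(inner ℝ Y (D X Z) : ℝ))
    (hDJ : ∀ X Y, D X (J Y) = -J (D X Y)) (hJD : ∀ X Y, D (J X) Y = -J (D X Y))
    (b : OrthonormalBasis ι ℝ V) (X : V) :
    ∑ A, ‖D X (b A)‖ ^ 2 ≤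
      3 / 4 * ‖X‖ ^ 2 * ∑ A, ∑ B, ‖(D - D.flip) (b A) (b B)‖ ^ 2 := by
  rcases eq_or_ne X 0 with rfl | hX
  · simp
  have hX' : 0 < ‖X‖ := norm_pos_iff.2 hX
  have h := sum_norm_sq_le_of_norm_eq_one hJ hJo hD hDJ hJD b
    (X := ‖X‖⁻¹ • X) (by rw [norm_smul, norm_inv, norm_norm, inv_mul_cancel₀ hX'.ne'])
  simp only [map_smul, LinearMap.smul_apply, norm_smul, norm_inv, norm_norm, mul_pow,
    ← Finset.mul_sum] at h
  rw [inv_pow, inv_mul_le_iff₀ (by positivity)] at h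
  linarith

/-- The lower bound for `φ(X, JX)`. By polarization `φ(X, JX)` is at least `|X|² - |D_X|² / 16` with
`D_X = Q_{JX} - J Q_X`. -/
theorem le_twistorForm {J : V →ₗ[ℝ] V} (hJ : ∀ X, J (J X) = -X)
    (hJo : ∀ X Y, inner ℝ (J X) (J Y) = (inner ℝ X Y : ℝ)) {Q : V →ₗ[ℝ] V →ₗ[ℝ] V}
    (hQ : ∀ X Y Z, inner ℝ (Q X Y) Z = -(inner ℝ Y (Q X Z) : ℝ))
    (hQJ : ∀ X Y, Q X (J Y) = -J (Q X Y)) {N : V → V → V}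
    (hN : ∀ X Y, N X Y = Q (J X) Y - Q (J Y) X + J (Q Y X) - J (Q X Y))
    (b : OrthonormalBasis ι ℝ V) (b' : OrthonormalBasis κ ℝ V) (X : V) :
    ‖X‖ ^ 2 * (1 - 3 / 64 * ∑ A, ∑ B, ‖N (b' A) (b' B)‖ ^ 2) ≤ twistorForm J Q b X (J X) := by
  have hJs : ∀ Y Z, inner ℝ (J Y) Z = -(inner ℝ Y (J Z) : ℝ) := fun Y Z ↦ by
    rw [← hJo Y (J Z), hJ, inner_neg_right, neg_neg]
  -- `D_X = Q_{JX} - J Q_X`, whose antisymmetrization is `N`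
  set D : V →ₗ[ℝ] V →ₗ[ℝ] V := Q ∘ₗ J - Q.compr₂ J with hDdef
  have hDa : ∀ X Y, D X Y = Q (J X) Y - J (Q X Y) := fun X Y ↦ rfl
  have hND : ∀ X Y, N X Y = (D - D.flip) X Y := fun X Y ↦ by
    rw [hN, LinearMap.sub_apply, LinearMap.sub_apply, LinearMap.flip_apply, hDa, hDa]
    abel
  have hD := sum_norm_sq_le hJ hJo (D := D)
    (fun X Y Z ↦ by
      rw [hDa, hDa, inner_sub_left, inner_sub_right, hQ, hJs, hQ, hQJ, inner_neg_right]; ring)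
    (fun X Y ↦ by rw [hDa, hDa, hQJ, hQJ, map_sub, map_neg]; abel)
    (fun X Y ↦ by rw [hDa, hDa, hJ, map_neg, map_sub, hJ, LinearMap.neg_apply]; abel) b X
  simp only [hND]
  rw [sum_sum_norm_sq_apply_eq _ b' b, twistorForm_apply, real_inner_self_eq_norm_sq,
    norm_apply_of_orth hJo]
  have h : -(1 / 4) * ∑ A, ‖D X (b A)‖ ^ 2 ≤
      ∑ A, (inner ℝ (J (Q X (b A))) (Q (J X) (b A)) : ℝ) := by
    rw [Finset.mul_sum]
    refine Finset.sum_le_sum fun A _ ↦ ?_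
    rw [hDa]
    have h1 := norm_sub_sq_real (Q (J X) (b A)) (J (Q X (b A)))
    have h2 := norm_add_sq_real (Q (J X) (b A)) (J (Q X (b A)))
    rw [real_inner_comm] at h1 h2
    nlinarith [sq_nonneg ‖Q (J X) (b A) + J (Q X (b A))‖]
  linarith

end LinearAlgebra

/-! ### The standard complex structure and skew endomorphisms -/

section Standard

variable {n : ℕ}

theorem J₀_J₀ (u : R2n n) : J₀ n (J₀ n u) = -u := by
  have h : J₀ n * J₀ n = -1 := by rw [J₀, ← map_mul, Matrix.J_squared, map_neg, map_one]
  exact DFunLike.congr_fun h u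

theorem isSkew_iff {m : End2n n} :
    IsSkew m ↔ ∀ u w, inner ℝ (m u) w = (-inner ℝ u (m w) : ℝ) := by
  rw [IsSkew, eq_comm, ContinuousLinearMap.eq_adjoint_iff]
  refine forall₂_congr fun u w ↦ ?_
  rw [_root_.neg_apply, inner_neg_left, neg_eq_iff_eq_neg]

theorem isSkew_J₀ : IsSkew (J₀ n) := by
  change star (J₀ n) = -J₀ n
  rw [J₀, ← map_star, Matrix.star_eq_conjTranspose, Matrix.conjTranspose_eq_transpose_of_trivial,
    Matrix.J_transpose, map_neg]

theorem isSkew_iff_stdVec {m : End2n n} :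
    IsSkew m ↔ ∀ A B, inner ℝ (m (stdVec n A)) (stdVec n B) +
      inner ℝ (stdVec n A) (m (stdVec n B)) = (0 : ℝ) := by
  refine ⟨fun h A B ↦ by rw [isSkew_iff.1 h, neg_add_cancel], fun h ↦ ?_⟩
  refine ext_stdVec fun A ↦ ?_
  ext B
  have h' := h A B
  rw [← ContinuousLinearMap.adjoint_inner_left, real_inner_comm, add_comm, ← real_inner_comm] at h'
  simp only [stdVec, EuclideanSpace.inner_single_left] at h'
  simp [stdVec] at h' ⊢
  linarith

theorem J₀_stdVec_inl (i : Fin n) : J₀ n (stdVec n (Sum.inl i)) = stdVec n (Sum.inr i) := by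
  ext A
  rw [J₀, Matrix.ofLp_toEuclideanCLM]
  rcases A with j | j <;> simp [stdVec, Matrix.J, Matrix.one_apply]

theorem J₀_stdVec_inr (i : Fin n) : J₀ n (stdVec n (Sum.inr i)) = -stdVec n (Sum.inl i) := by
  rw [← J₀_stdVec_inl, J₀_J₀]

/-- The projection of `𝔰𝔬(2n)` onto `Σ`, the part anticommuting with `J₀`. -/
def sigmaPart (m : End2n n) : End2n n := (1 / 2 : ℝ) • (m + J₀ n ∘L m ∘L J₀ n)

theorem sigmaPart_apply (m : End2n n) (u : R2n n) :
    sigmaPart m u = (1 / 2 : ℝ) • (m u + J₀ n (m (J₀ n u))) := rfl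

theorem sigmaPart_anti (m : End2n n) (u : R2n n) :
    sigmaPart m (J₀ n u) = -J₀ n (sigmaPart m u) := by
  rw [sigmaPart_apply, sigmaPart_apply, J₀_J₀, map_smul, map_add, J₀_J₀, map_neg, map_neg,
    ← smul_neg]
  congr 1
  abel

theorem sigmaPart_of_anti {m : End2n n} (hm : ∀ u, m (J₀ n u) = -J₀ n (m u)) : sigmaPart m = m := by
  ext1 u
  rw [sigmaPart_apply, hm, map_neg, J₀_J₀, neg_neg, ← two_smul ℝ, smul_smul]
  norm_num

/-- `½ (m + J₀ m J₀)` only depends on the commutator of `m` and `J₀`. -/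
theorem sigmaPart_congr {m m' : End2n n}
    (h : ∀ u, m (J₀ n u) - J₀ n (m u) = m' (J₀ n u) - J₀ n (m' u)) :
    sigmaPart m = sigmaPart m' := by
  ext1 u
  have h' := congrArg (J₀ n) (h u)
  rw [map_sub, map_sub, J₀_J₀, J₀_J₀, sub_neg_eq_add, sub_neg_eq_add] at h'
  rw [sigmaPart_apply, sigmaPart_apply, add_comm, h', add_comm]

theorem IsSkew.sigmaPart {m : End2n n} (hm : IsSkew m) : IsSkew (sigmaPart m) := by
  have hJ := isSkew_iff.1 (isSkew_J₀ (n := n))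
  rw [isSkew_iff] at hm ⊢
  intro u w
  rw [sigmaPart_apply, sigmaPart_apply, real_inner_smul_left, real_inner_smul_right, inner_add_left,
    inner_add_right, hm, hJ, hm, hJ]
  ring

/-- `Σ` is stable under multiplication by `J₀`. -/
theorem IsSkew.J₀_comp {m : End2n n} (hm : IsSkew m) (h : ∀ u, m (J₀ n u) = -J₀ n (m u)) :
    IsSkew (J₀ n ∘L m) := by
  have hJ := isSkew_iff.1 (isSkew_J₀ (n := n))
  rw [isSkew_iff] at hm ⊢
  intro u w
  change inner ℝ (J₀ n (m u)) w = (-inner ℝ u (J₀ n (m w)) : ℝ)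
  rw [hJ, hm, h, inner_neg_right, neg_neg]

end Standard

/-! ### Tangent vectors of the twistor bundle -/

section Twistor

set_option synthInstance.maxHeartbeats 200000

variable {n : ℕ} {M : Type*} [TopologicalSpace M] [ChartedSpace (Model n) M]
  [RiemannianBundle (fun x : M ↦ TangentSpace (𝓡 (2 * n)) x)]

/-- A frame which is a linear isometry of `ℝ^{2n}` onto the tangent space. -/
structure IsOrthonormalFrame (e : FrameSpace n M) : Prop where
  isInvertible : (e.snd : R2n n →L[ℝ] TangentSpace (𝓡 (2 * n)) e.proj).IsInvertible
  inner : ∀ u w, inner ℝ (e.snd u) (e.snd w) = (inner ℝ u w : ℝ)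

/-- The frame at `x` given by an orthonormal basis of the tangent space. -/
def frameOfBasis {x : M} (b : OrthonormalBasis (Fin n ⊕ Fin n) ℝ (TangentSpace (𝓡 (2 * n)) x)) :
    FrameSpace n M :=
  ⟨x, (b.repr.symm.toContinuousLinearEquiv : R2n n →L[ℝ] TangentSpace (𝓡 (2 * n)) x)⟩

theorem frameVec_frameOfBasis {x : M}
    (b : OrthonormalBasis (Fin n ⊕ Fin n) ℝ (TangentSpace (𝓡 (2 * n)) x)) (A : Fin n ⊕ Fin n) :
    frameVec (frameOfBasis b) A = b A :=
  b.repr_symm_single A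

theorem isOrthonormalFrame_frameOfBasis {x : M}
    (b : OrthonormalBasis (Fin n ⊕ Fin n) ℝ (TangentSpace (𝓡 (2 * n)) x)) :
    IsOrthonormalFrame (frameOfBasis b) :=
  ⟨⟨b.repr.symm.toContinuousLinearEquiv, rfl⟩, fun u w ↦ b.repr.symm.inner_map_map u w⟩

theorem xi_snd_apply {e : FrameSpace n M} (he : IsOrthonormalFrame e) (u : R2n n) :
    (xi e).snd (e.snd u) = e.snd (J₀ n u) :=
  congrArg (fun w ↦ e.snd (J₀ n w)) (he.isInvertible.inverse_apply_self u)

theorem IsOrthonormalFrame.of_mem_frameBundle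
    {o : ∀ x : M, Orientation ℝ (TangentSpace (𝓡 (2 * n)) x) (Fin n ⊕ Fin n)}
    {e : FrameSpace n M} (he : e ∈ frameBundle o) : IsOrthonormalFrame e := by
  obtain ⟨b, hb, -⟩ := he
  obtain ⟨x, L⟩ := e
  have h : L = (frameOfBasis b).snd := ext_stdVec fun A ↦
    (hb A).symm.trans (frameVec_frameOfBasis b A).symm
  have h' : (⟨x, L⟩ : FrameSpace n M) = frameOfBasis (x := x) b :=
    congrArg (TotalSpace.mk' (R2n n →L[ℝ] Model n) x) h
  rw [h']
  exact isOrthonormalFrame_frameOfBasis (x := x) b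

/-- Every point of the twistor bundle comes from a positive orthonormal frame. -/
theorem exists_mem_frameBundle_xi_eq
    {o : ∀ x : M, Orientation ℝ (TangentSpace (𝓡 (2 * n)) x) (Fin n ⊕ Fin n)}
    {j : EndSpace n M} (hj : j ∈ twistorBundle o) : ∃ e ∈ frameBundle o, xi e = j := by
  obtain ⟨x, j⟩ := j
  obtain ⟨hsq, -, b, hb, ho⟩ := hj
  refine ⟨frameOfBasis b, ⟨b, fun A ↦ (frameVec_frameOfBasis b A).symm, ho⟩, ?_⟩
  have he := isOrthonormalFrame_frameOfBasis b
  have h : ∀ A, (xi (frameOfBasis b)).snd (frameVec (frameOfBasis b) A) =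
      j (frameVec (frameOfBasis b) A) := by
    intro A
    refine (xi_snd_apply he (stdVec n A)).trans ?_
    rw [frameVec_frameOfBasis]
    rcases A with i | i
    · rw [J₀_stdVec_inl]
      exact (frameVec_frameOfBasis b _).trans (hb i)
    · rw [J₀_stdVec_inr]
      refine (map_neg (frameOfBasis b).snd _).trans ?_
      refine (congrArg Neg.neg (frameVec_frameOfBasis b (Sum.inl i))).trans ?_
      exact (hsq (b (Sum.inl i))).symm.trans (congrArg j (hb i).symm)
  have h' : (xi (frameOfBasis b)).snd = j := by
    refine ContinuousLinearMap.coe_injective (b.toBasis.ext fun A ↦ ?_)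
    have := h A
    rw [frameVec_frameOfBasis] at this
    exact (congrArg (xi (frameOfBasis b)).snd (b.coe_toBasis ▸ rfl)).trans
      (this.trans (congrArg j (b.coe_toBasis ▸ rfl)))
  exact congrArg (TotalSpace.mk' (Model n →L[ℝ] Model n) x) h'

variable [IsManifold (𝓡 (2 * n)) ∞ M] [IsContMDiffRiemannianBundle (𝓡 (2 * n)) ∞ (Model n)
  (fun x : M ↦ TangentSpace (𝓡 (2 * n)) x)]

/-- The tangent vector of the frame bundle at `e` with base component `v` on which the connection
form takes the value `m`. -/
def frameLift (e : FrameSpace n M) (v : TangentSpace (𝓡 (2 * n)) e.proj) (m : End2n n) :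
    TangentSpace (frameModel n) e :=
  frameTangent e v ((e.snd : R2n n →L[ℝ] TangentSpace (𝓡 (2 * n)) e.proj) ∘L m
    - christoffelL e.proj v ∘L e.snd)

variable {e : FrameSpace n M}

/-- `T_e P₊` consists of the vectors on which the connection form is skew. -/
theorem frameLift_mem_tangentFrame (he : IsOrthonormalFrame e)
    {v : TangentSpace (𝓡 (2 * n)) e.proj} {m : End2n n} :
    frameLift e v m ∈ tangentFrame e ↔ IsSkew m := by
  rw [frameLift, frameTangent_mem_tangentFrame, isSkew_iff_stdVec]
  refine forall₂_congr fun A B ↦ ?_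
  have h : ∀ A, ((e.snd : R2n n →L[ℝ] TangentSpace (𝓡 (2 * n)) e.proj) ∘L m
      - christoffelL e.proj v ∘L e.snd) (stdVec n A) + christoffel e.proj v (frameVec e A) =
      e.snd (m (stdVec n A)) := fun A ↦ sub_add_cancel (e.snd (m (stdVec n A))) _
  rw [h, h, frameVec, frameVec, he.inner, he.inner]

theorem exists_eq_frameLift (he : IsOrthonormalFrame e) (X : TangentSpace (frameModel n) e) :
    ∃ v m, X = frameLift e v m := by
  obtain ⟨v, a, rfl⟩ := exists_eq_frameTangent e X
  obtain ⟨ℓ, hℓ⟩ := he.isInvertible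
  refine ⟨v, ℓ.symm.toContinuousLinearMap ∘L (a + christoffelL e.proj v ∘L e.snd), ?_⟩
  refine congrArg (frameTangent e v) (ContinuousLinearMap.ext fun u ↦ ?_)
  have h : ∀ w, e.snd (ℓ.symm w) = w := fun w ↦
    (DFunLike.congr_fun hℓ (ℓ.symm w)).symm.trans (ℓ.apply_symm_apply w)
  change a u = e.snd (ℓ.symm (a u + christoffel e.proj v (e.snd u)))
    - christoffel e.proj v (e.snd u)
  rw [h, add_sub_cancel_right]

theorem Omega_frameLift (he : IsOrthonormalFrame e) (v : TangentSpace (𝓡 (2 * n)) e.proj)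
    {m : End2n n} (hm : IsSkew m) : Omega e (frameLift e v m) = m :=
  Omega_frameTangent he.isInvertible.injective hm fun u ↦
    (sub_add_cancel (e.snd (m u)) (christoffel e.proj v (e.snd u))).symm

/-- The differential of `ξ` only sees the commutator of the connection form and `J₀`. -/
theorem xiStar_frameLift (he : IsOrthonormalFrame e) (v : TangentSpace (𝓡 (2 * n)) e.proj)
    (m : End2n n) {J : TangentSpace (𝓡 (2 * n)) e.proj →L[ℝ] TangentSpace (𝓡 (2 * n)) e.proj}
    (hJ : (xi e).snd = J) :
    ∃ b : TangentSpace (𝓡 (2 * n)) e.proj →L[ℝ] TangentSpace (𝓡 (2 * n)) e.proj,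
      xiStar e (frameLift e v m) = endTangent (xi e) v b ∧
      ∀ u, e.snd (m (J₀ n u) - J₀ n (m u)) = b (e.snd u) +
        christoffel e.proj v (J (e.snd u)) -
        J (christoffel e.proj v (e.snd u)) := by
  obtain ⟨b, hb, h⟩ := xiStar_frameTangent he.isInvertible hJ v
    ((e.snd : R2n n →L[ℝ] TangentSpace (𝓡 (2 * n)) e.proj) ∘L m
      - christoffelL e.proj v ∘L e.snd)
  have hJe : ∀ u, J (e.snd u) = e.snd (J₀ n u) := fun u ↦
    (DFunLike.congr_fun hJ (e.snd u)).symm.trans (xi_snd_apply he u)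
  refine ⟨b, hb, fun u ↦ ?_⟩
  have h1 : b (e.snd u) = (e.snd (m (J₀ n u)) - christoffel e.proj v (e.snd (J₀ n u))) -
      J (e.snd (m u) - christoffel e.proj v (e.snd u)) := h u
  have h2 : J (e.snd (m u) - christoffel e.proj v (e.snd u)) =
      e.snd (J₀ n (m u)) - J (christoffel e.proj v (e.snd u)) :=
    (map_sub J _ _).trans
      (congrArg (· - J (christoffel e.proj v (e.snd u))) (hJe (m u)))
  rw [h1, h2, hJe]
  refine (map_sub e.snd _ _).trans ?_
  abel

/-- The isomorphism `λ(e)` in terms of lifts to the frame bundle. -/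
theorem lam_xiStar_frameLift (he : IsOrthonormalFrame e) (w : R2n n) {m : End2n n}
    (hm : IsSkew m) : lam e (xiStar e (frameLift e (e.snd w) m)) = (sigmaPart m, w) := by
  have hex : ∃ Y, Y ∈ tangentFrame e ∧ xiStar e Y = xiStar e (frameLift e (e.snd w) m) :=
    ⟨_, (frameLift_mem_tangentFrame he).2 hm, rfl⟩
  obtain ⟨h1, h2⟩ := Classical.epsilon_spec hex
  rw [lam]
  generalize (Classical.epsilon fun Y ↦ Y ∈ tangentFrame e ∧
    xiStar e Y = xiStar e (frameLift e (e.snd w) m)) = Y at h1 h2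
  obtain ⟨v', m', rfl⟩ := exists_eq_frameLift he Y
  have hm' := (frameLift_mem_tangentFrame he).1 h1
  obtain ⟨b, hb, hbm⟩ := xiStar_frameLift he (e.snd w) m rfl
  obtain ⟨b', hb', hbm'⟩ := xiStar_frameLift he v' m' rfl
  obtain ⟨hv, rfl⟩ := endTangent_inj (hb'.symm.trans (h2.trans hb))
  change v' = e.snd w at hv
  subst hv
  have hs : sigmaPart m' = sigmaPart m := sigmaPart_congr fun u ↦
    he.isInvertible.injective ((hbm' u).trans (hbm u).symm)
  refine Prod.ext ?_ (Theta_frameTangent he.inner w _)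
  change sigmaPart (Omega e (frameLift e (e.snd w) m')) = sigmaPart m
  rw [Omega_frameLift he _ hm', hs]

theorem lam_J₁_xiStar_frameLift (he : IsOrthonormalFrame e) (w : R2n n) {m : End2n n}
    (hm : IsSkew m) :
    lam e (J₁ e (xiStar e (frameLift e (e.snd w) m))) = (J₀ n ∘L sigmaPart m, J₀ n w) := by
  have hs : IsSkew (J₀ n ∘L sigmaPart m) := hm.sigmaPart.J₀_comp (sigmaPart_anti m)
  have hs' : sigmaPart (J₀ n ∘L sigmaPart m) = J₀ n ∘L sigmaPart m :=
    sigmaPart_of_anti fun u ↦ by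
      change J₀ n (sigmaPart m (J₀ n u)) = -J₀ n (J₀ n (sigmaPart m u))
      rw [sigmaPart_anti, map_neg]
  have hmodel : modelJ (lam e (xiStar e (frameLift e (e.snd w) m))) =
      (J₀ n ∘L sigmaPart m, J₀ n w) := by
    rw [lam_xiStar_frameLift he w hm, modelJ]
  have hex : ∃ Z, Z ∈ tangentTwistor e ∧
      lam e Z = modelJ (lam e (xiStar e (frameLift e (e.snd w) m))) :=
    ⟨xiStar e (frameLift e (e.snd (J₀ n w)) (J₀ n ∘L sigmaPart m)),
      Submodule.mem_map_of_mem ((frameLift_mem_tangentFrame he).2 hs),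
      by rw [lam_xiStar_frameLift he _ hs, hs', hmodel]⟩
  exact (Classical.epsilon_spec hex).2.trans hmodel

/-- The Kähler form at `ξ(e)` on tangent vectors of the twistor bundle. -/
theorem twistorMetric_J₁_xiStar (he : IsOrthonormalFrame e) (w w' : R2n n) {m m' : End2n n}
    (hm : IsSkew m) (hm' : IsSkew m') :
    twistorMetric e (J₁ e (xiStar e (frameLift e (e.snd w) m)))
      (xiStar e (frameLift e (e.snd w') m')) =
      soInner (J₀ n ∘L sigmaPart m) (sigmaPart m') + inner ℝ (J₀ n w) w' := by
  rw [twistorMetric, lam_J₁_xiStar_frameLift he w hm, lam_xiStar_frameLift he w' hm', modelInner]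

end Twistor

/-! ### The pull-back of the Kähler form -/

section Standard

variable {n : ℕ}

theorem isSkew_half_J₀_comp {q : End2n n} (hq : IsSkew q) (h : ∀ u, q (J₀ n u) = -J₀ n (q u)) :
    IsSkew ((1 / 2 : ℝ) • (J₀ n ∘L q)) := by
  have hs := isSkew_iff.1 (hq.J₀_comp h)
  rw [isSkew_iff]
  intro u w
  rw [smul_apply, smul_apply, real_inner_smul_left,
    real_inner_smul_right, hs]
  ring

theorem sigmaPart_half_J₀_comp {q : End2n n} (h : ∀ u, q (J₀ n u) = -J₀ n (q u)) :
    sigmaPart ((1 / 2 : ℝ) • (J₀ n ∘L q)) = (1 / 2 : ℝ) • (J₀ n ∘L q) :=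
  sigmaPart_of_anti fun u ↦ by
    change (1 / 2 : ℝ) • J₀ n (q (J₀ n u)) = -J₀ n ((1 / 2 : ℝ) • J₀ n (q u))
    rw [h, map_neg, map_smul, smul_neg]

theorem soInner_half_J₀_comp {q q' : End2n n} (hq : IsSkew q) :
    soInner (J₀ n ∘L ((1 / 2 : ℝ) • (J₀ n ∘L q))) ((1 / 2 : ℝ) • (J₀ n ∘L q')) =
      1 / 4 * ∑ A, inner ℝ (J₀ n (q (stdVec n A))) (q' (stdVec n A)) := by
  have hJ := isSkew_iff.1 (isSkew_J₀ (n := n))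
  rw [soInner, LinearMap.trace_eq_sum_inner _ (EuclideanSpace.basisFun (Fin n ⊕ Fin n) ℝ),
    ← Finset.sum_neg_distrib, Finset.mul_sum]
  refine Finset.sum_congr rfl fun A _ ↦ ?_
  rw [EuclideanSpace.basisFun_apply]
  change -inner ℝ (stdVec n A)
      (J₀ n ((1 / 2 : ℝ) • J₀ n (q ((1 / 2 : ℝ) • J₀ n (q' (stdVec n A)))))) =
    1 / 4 * inner ℝ (J₀ n (q (stdVec n A))) (q' (stdVec n A))
  rw [map_smul, map_smul, map_smul, map_smul, J₀_J₀, real_inner_smul_right, real_inner_smul_right,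
    inner_neg_right, hJ, isSkew_iff.1 hq]
  ring

end Standard

section Pullback

set_option synthInstance.maxHeartbeats 200000

variable {n : ℕ} {M : Type*} [TopologicalSpace M] [ChartedSpace (Model n) M]
  [RiemannianBundle (fun x : M ↦ TangentSpace (𝓡 (2 * n)) x)]

/-- The matrix of an endomorphism of the tangent space in a frame. -/
theorem IsOrthonormalFrame.exists_conj {e : FrameSpace n M} (he : IsOrthonormalFrame e)
    (Q : TangentSpace (𝓡 (2 * n)) e.proj →ₗ[ℝ] TangentSpace (𝓡 (2 * n)) e.proj) :
    ∃ q : End2n n, ∀ u, e.snd (q u) = Q (e.snd u) := by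
  obtain ⟨ℓ, hℓ⟩ := he.isInvertible
  refine ⟨ℓ.symm.toContinuousLinearMap ∘L LinearMap.toContinuousLinearMap (Q ∘ₗ
    (e.snd : R2n n →L[ℝ] TangentSpace (𝓡 (2 * n)) e.proj).toLinearMap), fun u ↦ ?_⟩
  exact (DFunLike.congr_fun hℓ _).symm.trans (ℓ.apply_symm_apply (Q (e.snd u)))

variable [IsManifold (𝓡 (2 * n)) ∞ M] [IsContMDiffRiemannianBundle (𝓡 (2 * n)) ∞ (Model n)
  (fun x : M ↦ TangentSpace (𝓡 (2 * n)) x)]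
  {J : ∀ x : M, TangentSpace (𝓡 (2 * n)) x →L[ℝ] TangentSpace (𝓡 (2 * n)) x}

/-- The differential of the section `S` given by `J`: in a frame with `ξ(e) = J`, its value on `v` is
the projection of the vector with connection form `½ J₀ q`, where `q` is the matrix of `∇_v J`. -/
theorem mfderiv_endSection (hJ : IsAlmostHermitian J) {e : FrameSpace n M}
    (he : IsOrthonormalFrame e) (hxi : (xi e).snd = J e.proj)
    (v : TangentSpace (𝓡 (2 * n)) e.proj) {q : End2n n}
    (hq : ∀ u, e.snd (q u) = nabla J e.proj v (e.snd u))
    (hqJ : ∀ u, q (J₀ n u) = -J₀ n (q u)) :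
    mfderiv (𝓡 (2 * n)) (endModel n) (endSection J) e.proj v =
      xiStar e (frameLift e v ((1 / 2 : ℝ) • (J₀ n ∘L q))) := by
  obtain ⟨b, hb, h⟩ := xiStar_frameLift he v ((1 / 2 : ℝ) • (J₀ n ∘L q)) hxi
  refine (mfderiv_endField (hJ.hasMFDerivAt e.proj) v).trans (Eq.trans ?_ hb.symm)
  refine congrArg (fun c : Model n →L[ℝ] Model n ↦ ((v, c) : Model n × (Model n →L[ℝ] Model n)))
    (ContinuousLinearMap.ext fun w ↦ ?_)
  obtain ⟨u, rfl⟩ : ∃ u, e.snd u = w := he.isInvertible.surjective w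
  have h1 : ((1 / 2 : ℝ) • (J₀ n ∘L q)) (J₀ n u) - J₀ n (((1 / 2 : ℝ) • (J₀ n ∘L q)) u) = q u := by
    change (1 / 2 : ℝ) • J₀ n (q (J₀ n u)) - J₀ n ((1 / 2 : ℝ) • J₀ n (q u)) = q u
    rw [hqJ, map_neg, map_smul, J₀_J₀, neg_neg, smul_neg, sub_neg_eq_add, ← add_smul]
    norm_num
  have h2 := (congrArg e.snd h1).symm.trans (h u)
  have h3 : endDerivMap J e.proj v (e.snd u) = b (e.snd u) := by
    have h4 := (hq u).symm.trans h2
    rw [nabla_apply] at h4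
    exact add_right_cancel (sub_left_injective h4)
  exact h3

/-- The form `φ = S^*Φ` is `⟨JX, Y⟩ - ¼ tr (J ∇_X J ∇_Y J)`. -/
theorem phi_eq {o : ∀ x : M, Orientation ℝ (TangentSpace (𝓡 (2 * n)) x) (Fin n ⊕ Fin n)}
    (hJ : IsAlmostHermitian J) {x : M} (hS : endSection J x ∈ twistorBundle o) :
    ∃ b : OrthonormalBasis (Fin n ⊕ Fin n) ℝ (TangentSpace (𝓡 (2 * n)) x),
      ∀ X Y, twistorForm (J x).toLinearMap (nabla J x) b X Y = phi o J x X Y := by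
  have hex := exists_mem_frameBundle_xi_eq hS
  have : Nonempty (FrameSpace n M) := ⟨⟨x, 0⟩⟩
  have hspec := Classical.epsilon_spec (p := fun e ↦ e ∈ frameBundle o ∧ xi e = endSection J x) hex
  suffices key : ∀ e : FrameSpace n M, e ∈ frameBundle o → xi e = endSection J x →
      ∃ b : OrthonormalBasis (Fin n ⊕ Fin n) ℝ (TangentSpace (𝓡 (2 * n)) x),
      ∀ X Y, twistorForm (J x).toLinearMap (nabla J x) b X Y = twistorMetric e
        (J₁ e (mfderiv (𝓡 (2 * n)) (endModel n) (endSection J) x X))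
        (mfderiv (𝓡 (2 * n)) (endModel n) (endSection J) x Y) from key _ hspec.1 hspec.2
  -- `Φ` may be computed with any positive orthonormal frame over `J`, here with `e = (x', L)`
  intro e heo hxi
  obtain ⟨x', L⟩ := e
  obtain rfl : x' = x := congrArg TotalSpace.proj hxi
  have he := IsOrthonormalFrame.of_mem_frameBundle heo
  obtain ⟨b, hb, -⟩ := heo
  have hxi' : (xi ⟨x', L⟩).snd = J x' := 
    TotalSpace.mk_injective (F := Model n →L[ℝ] Model n)
      (E := fun x : M ↦ TangentSpace (𝓡 (2 * n)) x →L[ℝ] TangentSpace (𝓡 (2 * n)) x) x' hxi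
  refine ⟨b, fun X Y ↦ ?_⟩
  have hJL : ∀ u, L (J₀ n u) = J x' (L u) := fun u ↦
    (xi_snd_apply he u).symm.trans (DFunLike.congr_fun hxi' (L u))
  have hmat : ∀ v, ∃ q : End2n n, (∀ u, L (q u) = nabla J x' v (L u)) ∧ IsSkew q ∧
      ∀ u, q (J₀ n u) = -J₀ n (q u) := by
    intro v
    obtain ⟨q, hq⟩ := he.exists_conj (nabla J x' v)
    change ∀ u, L (q u) = nabla J x' v (L u) at hq
    refine ⟨q, hq, isSkew_iff.2 fun u w ↦ ?_, fun u ↦ he.isInvertible.injective ?_⟩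
    · rw [← he.inner, ← he.inner]
      change inner ℝ (L (q u)) (L w) = -inner ℝ (L u) (L (q w))
      rw [hq, hq, nabla_skew hJ]
    · change L (q (J₀ n u)) = L (-J₀ n (q u))
      rw [hq, hJL, nabla_anti hJ, ← hq, ← hJL, map_neg]
  obtain ⟨q, hq, hqs, hqJ⟩ := hmat X
  obtain ⟨q', hq', hqs', hqJ'⟩ := hmat Y
  obtain ⟨w, hw⟩ : ∃ w, L w = X := he.isInvertible.surjective X
  obtain ⟨w', hw'⟩ : ∃ w', L w' = Y := he.isInvertible.surjective Y
  have hX := mfderiv_endSection hJ he hxi' X hq hqJ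
  have hY := mfderiv_endSection hJ he hxi' Y hq' hqJ'
  refine Eq.trans ?_ (congrArg₂ (fun P R ↦ twistorMetric ⟨x', L⟩ (J₁ ⟨x', L⟩ P) R) hX hY).symm
  subst hw hw'
  refine Eq.trans ?_ (twistorMetric_J₁_xiStar he w w' (isSkew_half_J₀_comp hqs hqJ)
    (isSkew_half_J₀_comp hqs' hqJ')).symm
  rw [sigmaPart_half_J₀_comp hqJ, sigmaPart_half_J₀_comp hqJ', soInner_half_J₀_comp hqs, add_comm,
    twistorForm_apply, ← he.inner]
  have hsum : ∀ A, (inner ℝ (J x' (nabla J x' (L w) (b A))) (nabla J x' (L w') (b A)) : ℝ) =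
      inner ℝ (J₀ n (q (stdVec n A))) (q' (stdVec n A)) := by
    intro A
    have hbA : b A = L (stdVec n A) := hb A
    rw [hbA, ← hq, ← hq', ← hJL]
    exact he.inner _ _
  have hJw : J x' (L w) = L (J₀ n w) := (hJL w).symm
  refine congrArg₂ (· + ·) ?_ ?_
  · exact congrArg (fun z ↦ inner ℝ z (L w')) hJw
  · exact congrArg (1 / 4 * ·) (Finset.sum_congr rfl fun A _ ↦ hsum A)

end Pullback

end AlmostHermitian

end


theorem theorem1 (n : ℕ) {M : Type*} [TopologicalSpace M]
    [ChartedSpace (AlmostHermitian.Model n) M] [IsManifold (𝓡 (2 * n)) ∞ M]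
    [RiemannianBundle (fun x : M ↦ TangentSpace (𝓡 (2 * n)) x)]
    [IsContMDiffRiemannianBundle (𝓡 (2 * n)) ∞ (AlmostHermitian.Model n)
      (fun x : M ↦ TangentSpace (𝓡 (2 * n)) x)]
    (o : ∀ x : M, Orientation ℝ (TangentSpace (𝓡 (2 * n)) x) (Fin n ⊕ Fin n))
    (J : ∀ x : M, TangentSpace (𝓡 (2 * n)) x →L[ℝ] TangentSpace (𝓡 (2 * n)) x)
    (hJ : AlmostHermitian.IsAlmostHermitian J)
    (hS : ∀ x : M, AlmostHermitian.endSection J x ∈ AlmostHermitian.twistorBundle o) :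
    ∃ φ : ∀ x : M, LinearMap.BilinForm ℝ (TangentSpace (𝓡 (2 * n)) x),
      (∀ x X Y, φ x X Y = AlmostHermitian.phi o J x X Y) ∧
      (∀ x, (φ x).IsAlt) ∧
      (3 ≤ n →
        (∀ (x : M) (X : TangentSpace (𝓡 (2 * n)) x),
          ‖X‖ ^ 2 * (1 - 5 / 64 * AlmostHermitian.nijenhuisNormSq J x) ≤ φ x X (J x X)) ∧
        (∀ x : M, AlmostHermitian.nijenhuisNormSq J x < 64 / 5 → (φ x).Nondegenerate)) ∧
      (n = 2 →
        (∀ (x : M) (X : TangentSpace (𝓡 (2 * n)) x),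
          ‖X‖ ^ 2 * (1 - 1 / 16 * AlmostHermitian.nijenhuisNormSq J x) ≤ φ x X (J x X)) ∧
        (∀ x : M, AlmostHermitian.nijenhuisNormSq J x < 16 → (φ x).Nondegenerate)) := by
  choose b hb using fun x ↦ AlmostHermitian.phi_eq hJ (hS x)
  let φ : ∀ x : M, LinearMap.BilinForm ℝ (TangentSpace (𝓡 (2 * n)) x) := fun x ↦
    AlmostHermitian.twistorForm (J x).toLinearMap (AlmostHermitian.nabla J x) (b x)
  have halt : ∀ x, (φ x).IsAlt := fun x ↦
    AlmostHermitian.twistorForm_isAlt (hJ.sq x) (hJ.orth x) _ (b x)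
  have hN : ∀ x, 0 ≤ AlmostHermitian.nijenhuisNormSq J x := fun x ↦
    Finset.sum_nonneg fun _ _ ↦ Finset.sum_nonneg fun _ _ ↦ sq_nonneg _
  have hle : ∀ (c : ℝ), 3 / 64 ≤ c → ∀ (x : M) (X : TangentSpace (𝓡 (2 * n)) x),
      ‖X‖ ^ 2 * (1 - c * AlmostHermitian.nijenhuisNormSq J x) ≤ φ x X (J x X) := by
    intro c hc x X
    refine le_trans ?_ (AlmostHermitian.le_twistorForm (hJ.sq x) (hJ.orth x)
      (AlmostHermitian.nabla_skew hJ x) (AlmostHermitian.nabla_anti hJ x)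
      (AlmostHermitian.nijenhuis_eq hJ x) (b x) (stdOrthonormalBasis ℝ _) X)
    exact mul_le_mul_of_nonneg_left
      (sub_le_sub_left (mul_le_mul_of_nonneg_right hc (hN x)) 1) (sq_nonneg _)
  have hnd : ∀ (c : ℝ), 3 / 64 ≤ c → ∀ x : M, c * AlmostHermitian.nijenhuisNormSq J x < 1 →
      (φ x).Nondegenerate := fun c hc x hx ↦
    AlmostHermitian.nondegenerate_of_isAlt_of_pos (halt x) (J x) fun X hX ↦
      (mul_pos (pow_pos (norm_pos_iff.2 hX) 2) (sub_pos.2 hx)).trans_le (hle c hc x X)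
  refine ⟨φ, hb, halt, fun _ ↦ ⟨hle _ (by norm_num), fun x hx ↦ hnd (5 / 64) (by norm_num) x ?_⟩,
    fun _ ↦ ⟨hle _ (by norm_num), fun x hx ↦ hnd (1 / 16) (by norm_num) x ?_⟩⟩ <;> linarith
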